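/- Let $a$ and $b$ be non-negative integers. Every finite simple graph $G$ of pathwidth less than $a$ that has no path on $2^b$ vertices as a (not necessarily induced) subgraph has treedepth at most $10ab$. Here a path decomposition of $G$ consists of a path $P$ with at least one node and a bag $B_t\subseteq V(G)$ for each node $t$ of $P$, such that both ends of every edge of $G$ lie in a common bag and, for every vertex $v$ of $G$, the nodes $t$ with $v\in B_t$ induce a non-empty subpath of $P$; its width is $\max_t|B_t|-1$, and the pathwidth of $G$ is the minimum width of a path decomposition of $G$. An elimination forest of $G$ is a rooted forest $F$ with $V(F)=V(G)$ such that for every edge $uv$ of $G$ one of $u$ and $v$ lies on the path in $F$ from a root to the other; its height is the maximum number of vertices on a path from a root to a leaf ($0$ if $F$ is empty), and the treedepth of $G$ is the minimum height of an elimination forest of $G$. -/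

import Mathlib

/-- A rooted forest with vertex set `V`: an acyclic graph on `V` together with a set of roots that
contains exactly one vertex of each connected component (each tree of the forest). -/
structure RootedForest (V : Type*) where
  graph : SimpleGraph V
  isAcyclic : graph.IsAcyclic
  roots : Set V
  existsUnique_root : ∀ v : V, ∃! r : V, r ∈ roots ∧ graph.Reachable r v

namespace RootedForest

variable {V : Type*}

/-- `u` is an ancestor of `v` if `u` lies on the path from a root to `v`
(every vertex is an ancestor of itself). -/
def IsAncestor (F : RootedForest V) (u v : V) : Prop :=
  ∃ r ∈ F.roots, ∃ p : F.graph.Walk r v, p.IsPath ∧ u ∈ p.support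

/-- A leaf is a vertex without descendants other than itself. -/
def IsLeaf (F : RootedForest V) (v : V) : Prop :=
  ∀ w : V, F.IsAncestor v w → w = v

/-- The maximum number of vertices on a path from a root to a leaf (`0` for the empty forest).
A path with `p.length` edges has `p.length + 1` vertices. -/
noncomputable def height (F : RootedForest V) : ℕ :=
  sSup {k : ℕ | ∃ r ∈ F.roots, ∃ l : V, F.IsLeaf l ∧
    ∃ p : F.graph.Walk r l, p.IsPath ∧ p.length + 1 = k}

/-- `F` is an elimination forest of `G`: for every edge of `G`, one of its ends is an ancestor of
the other in `F`. -/
def IsEliminationForest (F : RootedForest V) (G : SimpleGraph V) : Prop :=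
  ∀ u v : V, G.Adj u v → F.IsAncestor u v ∨ F.IsAncestor v u

end RootedForest

/-- The treedepth of a finite graph: the minimum height of an elimination forest. -/
noncomputable def treedepth {V : Type*} (G : SimpleGraph V) : ℕ :=
  sInf {h : ℕ | ∃ F : RootedForest V, F.IsEliminationForest G ∧ F.height = h}

/-- A path decomposition of `G` whose path has the nodes `0, 1, …, n` in this order. The subtrees
of that path are its nonempty intervals. -/
structure PathDecomposition {V : Type*} (G : SimpleGraph V) (n : ℕ) where
  bag : Fin (n + 1) → Finset V
  exists_bag_of_adj : ∀ u v : V, G.Adj u v → ∃ t, u ∈ bag t ∧ v ∈ bag t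
  nonempty_nodes : ∀ v : V, {t | v ∈ bag t}.Nonempty
  ordConnected_nodes : ∀ v : V, {t | v ∈ bag t}.OrdConnected

/-- The maximum size of a bag minus `1`, as an integer (it is `-1` if all bags are empty). -/
def PathDecomposition.width {V : Type*} {G : SimpleGraph V} {n : ℕ}
    (D : PathDecomposition G n) : ℤ :=
  ((Finset.univ.sup fun t => (D.bag t).card : ℕ) : ℤ) - 1

/-- The pathwidth of a finite graph: the minimum width of a path decomposition. -/
noncomputable def pathwidth {V : Type*} (G : SimpleGraph V) : ℤ :=
  sInf {w : ℤ | ∃ (n : ℕ) (D : PathDecomposition G n), D.width = w}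

/-!
The proof views a path decomposition as a sweep: a chain of separations `(C, A)` of order at most
`a`, leading from one end of the graph to the other, in which single vertices enter `A` and later
leave through `C`. The order `|A| - |C|` is a modular function, and uncrossing shows that a sweep of
minimum total order is linked (`IsSweep.exists_isLinkedSweep`): between two of its members, no
separation has smaller order than all members of the sweep in that range. By a form of Menger's
theorem, derived here from Hall's theorem (`exists_isLinkage_of_card_le`), if all members in a
window of a linked sweep have order at least `k`, then `k` disjoint paths run from one end of the
window to the other.

The elimination forest is then built by recursion on windows (`IsSweep.exists_elimBound`). In a
window with `κ` disjoint paths, `q` of which are nontrivial, a member of order at most `κ + q` can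
be deleted at the cost of at most `2 * q` new vertices, since every trivial path already accounts for
one vertex of it. Deleting it splits the paths, and the sum over the paths of `1 + log₂ (length)`
drops, on one of the two sides, by at least half of the cost. The window is cut at two neighbouring
members of this kind, one light to its left and one light to its right; between them every member
has order more than `κ + q`, so that there are more than `κ + q` disjoint paths. The lengths of the
new paths are not controlled by the old ones, only by the longest path of `G`. This is made up for
by the number of paths, which is at most `a`: at least `q + 1` paths are gained, while the trivial
paths persist. The potential `10 * b * (a - κ) + 4 * ∑ (1 + log₂ (length))` (`levelBudget`), with the
sum over the nontrivial paths, combines the two kinds of progress; it is `10 * a * b` at the start,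
with no paths.
-/

/-! ### Elimination forests built step by step -/

/-- `ElimBound G k S` says that the subgraph of `G` induced on `S` has an elimination forest with
at most `k` levels, built up by adding a root below which everything else hangs and by taking
disjoint unions without edges between the parts. -/
inductive ElimBound {V : Type*} [DecidableEq V] (G : SimpleGraph V) : ℕ → Finset V → Prop
  | empty (k : ℕ) : ElimBound G k ∅
  | insert {k : ℕ} {S : Finset V} (x : V) (hx : x ∉ S) (h : ElimBound G k S) :
      ElimBound G (k + 1) (insert x S)
  | union {k : ℕ} {S T : Finset V} (hS : ElimBound G k S) (hT : ElimBound G k T)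
      (hd : Disjoint S T) (hadj : ∀ u ∈ S, ∀ v ∈ T, ¬ G.Adj u v) : ElimBound G k (S ∪ T)

/-- Parent-and-level data of an elimination forest of the subgraph of `G` induced on `S` with at
most `k` levels: `r a b` means that `a` is the parent of `b`, and `d` is the level, which is `0`
at the roots. -/
structure IsElimData {V : Type*} (G : SimpleGraph V) (k : ℕ) (S : Finset V)
    (r : V → V → Prop) (d : V → ℕ) : Prop where
  left_mem : ∀ {a b}, r a b → a ∈ S
  right_mem : ∀ {a b}, r a b → b ∈ S
  level : ∀ {a b}, r a b → d b = d a + 1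
  unique : ∀ {a a' b}, r a b → r a' b → a = a'
  exists_parent : ∀ b ∈ S, d b ≠ 0 → ∃ a, r a b
  lt : ∀ b ∈ S, d b < k
  adj : ∀ u ∈ S, ∀ v ∈ S, G.Adj u v → Relation.ReflTransGen r u v ∨ Relation.ReflTransGen r v u

namespace ElimBound

variable {V : Type*} [DecidableEq V] {G : SimpleGraph V}

theorem mono {k : ℕ} {S : Finset V} (h : ElimBound G k S) : ∀ {k' : ℕ}, k ≤ k' →
    ElimBound G k' S := by
  induction h with
  | empty k => intro k' _; exact .empty k'
  | insert x hx _ ih =>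
    intro k' hk
    obtain ⟨m, rfl⟩ : ∃ m, k' = m + 1 := ⟨k' - 1, by omega⟩
    exact .insert x hx (ih (by omega))
  | union _ _ hd hadj ih₁ ih₂ => intro k' hk; exact .union (ih₁ hk) (ih₂ hk) hd hadj

theorem subset {k : ℕ} {S : Finset V} (h : ElimBound G k S) : ∀ {S' : Finset V}, S' ⊆ S →
    ElimBound G k S' := by
  induction h with
  | empty k => intro S' hS; rw [Finset.subset_empty.1 hS]; exact .empty k
  | @insert k S x hx _ ih =>
    intro S' hS
    by_cases hxS : x ∈ S'
    · rw [← Finset.insert_erase hxS]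
      refine .insert x (Finset.notMem_erase x S') (ih ?_)
      rwa [← Finset.subset_insert_iff]
    · exact (ih ((Finset.subset_insert_iff_of_notMem hxS).1 hS)).mono (Nat.le_succ k)
  | @union k S T _ _ hd hadj ih₁ ih₂ =>
    intro S' hS
    have : S' = (S' ∩ S) ∪ (S' ∩ T) := by
      rw [← Finset.inter_union_distrib_left, Finset.inter_eq_left.2 hS]
    rw [this]
    refine .union (ih₁ Finset.inter_subset_right) (ih₂ Finset.inter_subset_right)
      (hd.mono Finset.inter_subset_right Finset.inter_subset_right) ?_
    intro u hu v hv
    exact hadj u (Finset.mem_inter.1 hu).2 v (Finset.mem_inter.1 hv).2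

theorem union_card {k : ℕ} {S : Finset V} (h : ElimBound G k S) (X : Finset V) :
    ElimBound G (k + X.card) (S ∪ X) := by
  induction X using Finset.induction_on with
  | empty => simpa using h
  | insert x X hx ih =>
    rw [Finset.card_insert_of_notMem hx, Finset.union_insert, ← add_assoc]
    by_cases hxS : x ∈ S ∪ X
    · rw [Finset.insert_eq_of_mem hxS]; exact ih.mono (Nat.le_succ _)
    · exact .insert x hxS ih

theorem exists_isElimData {k : ℕ} {S : Finset V} (h : ElimBound G k S) :
    ∃ r d, IsElimData G k S r d := by
  induction h with
  | empty k =>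
    exact ⟨fun _ _ => False, fun _ => 0, by constructor <;> simp⟩
  | @insert k S x hx _ ih =>
    obtain ⟨r, d, hr⟩ := ih
    have hne : ∀ b ∈ S, b ≠ x := fun b hb hbx => hx (hbx ▸ hb)
    let r' : V → V → Prop := fun a b => r a b ∨ (a = x ∧ b ∈ S ∧ d b = 0)
    let d' : V → ℕ := fun b => if b = x then 0 else d b + 1
    have hd' : ∀ b ∈ S, d' b = d b + 1 := fun b hb => if_neg (hne b hb)
    have hdx : d' x = 0 := if_pos rfl
    have hle : ∀ u v, Relation.ReflTransGen r u v → Relation.ReflTransGen r' u v :=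
      fun u v => Relation.ReflTransGen.mono (fun _ _ => Or.inl) u v
    have hroot : ∀ n, ∀ v ∈ S, d v = n → Relation.ReflTransGen r' x v := by
      intro n
      induction n with
      | zero => intro v hv h0; exact .single (Or.inr ⟨rfl, hv, h0⟩)
      | succ n ihn =>
        intro v hv hn
        obtain ⟨a, ha⟩ := hr.exists_parent v hv (by omega)
        exact (ihn a (hr.left_mem ha) (by have := hr.level ha; omega)).tail (Or.inl ha)
    refine ⟨r', d', ?_, ?_, ?_, ?_, ?_, ?_, ?_⟩
    · rintro a b (h | ⟨rfl, _⟩)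
      · exact Finset.mem_insert_of_mem (hr.left_mem h)
      · exact Finset.mem_insert_self _ _
    · rintro a b (h | ⟨_, h, _⟩)
      · exact Finset.mem_insert_of_mem (hr.right_mem h)
      · exact Finset.mem_insert_of_mem h
    · rintro a b (h | ⟨rfl, h, h0⟩)
      · rw [hd' _ (hr.left_mem h), hd' _ (hr.right_mem h), hr.level h]
      · rw [hd' _ h, hdx, h0]
    · rintro a a' b (h | ⟨rfl, h, h0⟩) (h' | ⟨rfl, h', h0'⟩)
      · exact hr.unique h h'
      · have := hr.level h; omega
      · have := hr.level h'; omega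
      · rfl
    · intro b hb hb0
      rcases Finset.mem_insert.1 hb with rfl | hb
      · exact absurd hdx hb0
      · by_cases h0 : d b = 0
        · exact ⟨x, Or.inr ⟨rfl, hb, h0⟩⟩
        · obtain ⟨a, ha⟩ := hr.exists_parent b hb h0
          exact ⟨a, Or.inl ha⟩
    · intro b hb
      rcases Finset.mem_insert.1 hb with rfl | hb
      · rw [hdx]; omega
      · rw [hd' b hb]; have := hr.lt b hb; omega
    · intro u hu v hv huv
      rcases Finset.mem_insert.1 hu with rfl | huS <;>
        rcases Finset.mem_insert.1 hv with rfl | hvS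
      · exact Or.inl .refl
      · exact Or.inl (hroot _ v hvS rfl)
      · exact Or.inr (hroot _ u huS rfl)
      · exact (hr.adj u huS v hvS huv).imp (hle _ _) (hle _ _)
  | @union k S T _ _ hd hadj ih₁ ih₂ =>
    obtain ⟨r₁, d₁, h₁⟩ := ih₁
    obtain ⟨r₂, d₂, h₂⟩ := ih₂
    let r' : V → V → Prop := fun a b => r₁ a b ∨ r₂ a b
    let d' : V → ℕ := fun b => if b ∈ S then d₁ b else d₂ b
    have hdS : ∀ b ∈ S, d' b = d₁ b := fun b hb => if_pos hb
    have hdT : ∀ b ∈ T, d' b = d₂ b := fun b hb => if_neg (Finset.disjoint_right.1 hd hb)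
    have hle₁ : ∀ u v, Relation.ReflTransGen r₁ u v → Relation.ReflTransGen r' u v :=
      fun u v => Relation.ReflTransGen.mono (fun _ _ => Or.inl) u v
    have hle₂ : ∀ u v, Relation.ReflTransGen r₂ u v → Relation.ReflTransGen r' u v :=
      fun u v => Relation.ReflTransGen.mono (fun _ _ => Or.inr) u v
    refine ⟨r', d', ?_, ?_, ?_, ?_, ?_, ?_, ?_⟩
    · rintro a b (h | h)
      · exact Finset.mem_union_left _ (h₁.left_mem h)
      · exact Finset.mem_union_right _ (h₂.left_mem h)
    · rintro a b (h | h)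
      · exact Finset.mem_union_left _ (h₁.right_mem h)
      · exact Finset.mem_union_right _ (h₂.right_mem h)
    · rintro a b (h | h)
      · rw [hdS _ (h₁.left_mem h), hdS _ (h₁.right_mem h), h₁.level h]
      · rw [hdT _ (h₂.left_mem h), hdT _ (h₂.right_mem h), h₂.level h]
    · rintro a a' b (h | h) (h' | h')
      · exact h₁.unique h h'
      · exact absurd (h₂.right_mem h') (Finset.disjoint_left.1 hd (h₁.right_mem h))
      · exact absurd (h₂.right_mem h) (Finset.disjoint_left.1 hd (h₁.right_mem h'))
      · exact h₂.unique h h'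
    · intro b hb hb0
      rcases Finset.mem_union.1 hb with hb | hb
      · rw [hdS b hb] at hb0
        exact (h₁.exists_parent b hb hb0).imp fun _ => Or.inl
      · rw [hdT b hb] at hb0
        exact (h₂.exists_parent b hb hb0).imp fun _ => Or.inr
    · intro b hb
      rcases Finset.mem_union.1 hb with hb | hb
      · rw [hdS b hb]; exact h₁.lt b hb
      · rw [hdT b hb]; exact h₂.lt b hb
    · intro u hu v hv huv
      rcases Finset.mem_union.1 hu with hu | hu <;> rcases Finset.mem_union.1 hv with hv | hv
      · exact (h₁.adj u hu v hv huv).imp (hle₁ _ _) (hle₁ _ _)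
      · exact absurd huv (hadj u hu v hv)
      · exact absurd huv.symm (hadj v hv u hu)
      · exact (h₂.adj u hu v hv huv).imp (hle₂ _ _) (hle₂ _ _)

end ElimBound

namespace IsElimData

variable {V : Type*} {G : SimpleGraph V} {k : ℕ} {S : Finset V}
  {r : V → V → Prop} {d : V → ℕ}

theorem level_le (h : IsElimData G k S r d) {u v : V} (huv : Relation.ReflTransGen r u v) :
    d u ≤ d v := by
  induction huv with
  | refl => exact le_rfl
  | tail _ hr ih => have := h.level hr; omega

theorem eq_of_level_eq_zero (h : IsElimData G k S r d) {u v : V}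
    (huv : Relation.ReflTransGen r u v) (hv : d v = 0) : u = v := by
  rcases Relation.ReflTransGen.cases_tail huv with h' | ⟨c, _, hc⟩
  · exact h'.symm
  · have := h.level hc; omega

theorem exists_root (h : IsElimData G k S r d) {v : V} (hv : v ∈ S) :
    ∃ u, d u = 0 ∧ Relation.ReflTransGen r u v := by
  induction hn : d v generalizing v with
  | zero => exact ⟨v, hn, .refl⟩
  | succ n ih =>
    obtain ⟨a, ha⟩ := h.exists_parent v hv (by omega)
    obtain ⟨u, hu, hua⟩ := ih (h.left_mem ha) (by have := h.level ha; omega)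
    exact ⟨u, hu, hua.tail ha⟩

/-- The undirected graph that joins every vertex to its parent. -/
def forestGraph (h : IsElimData G k S r d) : SimpleGraph V where
  Adj a b := r a b ∨ r b a
  symm := ⟨fun _ _ => Or.symm⟩
  loopless := ⟨fun a ha => by rcases ha with ha | ha <;> · have := h.level ha; omega⟩

theorem reachable_of_reflTransGen (h : IsElimData G k S r d) {u v : V}
    (huv : Relation.ReflTransGen r u v) : h.forestGraph.Reachable u v := by
  induction huv with
  | refl => rfl
  | tail _ hr ih => exact ih.trans (SimpleGraph.Adj.reachable (Or.inl hr))

theorem reflTransGen_of_reachable (h : IsElimData G k S r d) {u v : V} (hu : d u = 0)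
    (huv : h.forestGraph.Reachable u v) : Relation.ReflTransGen r u v := by
  rw [SimpleGraph.reachable_iff_reflTransGen] at huv
  induction huv with
  | refl => exact .refl
  | @tail b c _ hbc ih =>
    rcases hbc with hbc | hbc
    · exact ih.tail hbc
    · rcases Relation.ReflTransGen.cases_tail ih with rfl | ⟨a, ha, hab⟩
      · have := h.level hbc; omega
      · rwa [h.unique hbc hab]

/-- Every edge is a bridge, because the descendants of a vertex are closed under adjacency once
the edge to its parent is removed. -/
theorem forestGraph_isAcyclic (h : IsElimData G k S r d) : h.forestGraph.IsAcyclic := by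
  have key : ∀ {a b}, r a b →
      ¬ (h.forestGraph \ SimpleGraph.fromEdgeSet {s(a, b)}).Reachable b a := by
    intro a b hab hreach
    rw [SimpleGraph.reachable_iff_reflTransGen] at hreach
    have hdesc : ∀ z, Relation.ReflTransGen
        (h.forestGraph \ SimpleGraph.fromEdgeSet {s(a, b)}).Adj b z →
        Relation.ReflTransGen r b z := by
      intro z hz
      induction hz with
      | refl => exact .refl
      | @tail c e _ hce ih =>
        rw [SimpleGraph.sdiff_adj] at hce
        obtain ⟨hce | hce, hne⟩ := hce
        · exact ih.tail hce
        · rcases Relation.ReflTransGen.cases_tail ih with rfl | ⟨f, hf, hfc⟩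
          · obtain rfl := h.unique hab hce
            exfalso
            apply hne
            have := h.level hab
            rw [SimpleGraph.fromEdgeSet_adj]
            refine ⟨Sym2.eq_swap, ?_⟩
            rintro rfl
            omega
          · rwa [h.unique hce hfc]
    have h₁ := h.level_le (hdesc a hreach)
    have h₂ := h.level hab
    omega
  rw [SimpleGraph.isAcyclic_iff_forall_adj_isBridge]
  intro v w hvw
  rw [SimpleGraph.isBridge_iff]
  rcases hvw with hvw | hvw
  · intro hr; exact key hvw hr.symm
  · rw [Sym2.eq_swap]; exact key hvw

theorem exists_path (h : IsElimData G k S r d) {u v w : V} (p : h.forestGraph.Walk u v)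
    (hp : p.IsPath) (hlen : p.length + d u = d v) (hsup : ∀ x ∈ p.support, d x ≤ d v)
    (hvw : Relation.ReflTransGen r v w) :
    ∃ q : h.forestGraph.Walk u w, q.IsPath ∧ q.length + d u = d w ∧
      (∀ x ∈ q.support, d x ≤ d w) ∧ v ∈ q.support := by
  induction hvw with
  | refl => exact ⟨p, hp, hlen, hsup, p.end_mem_support⟩
  | @tail b c _ hbc ih =>
    obtain ⟨q, hq, hql, hqs, hv⟩ := ih
    have hl := h.level hbc
    have hadj : h.forestGraph.Adj b c := Or.inl hbc
    refine ⟨q.concat hadj, hq.concat ?_ hadj, ?_, ?_, ?_⟩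
    · intro hc; have := hqs c hc; omega
    · rw [SimpleGraph.Walk.length_concat]; omega
    · intro x hx
      rw [SimpleGraph.Walk.support_concat, List.mem_append] at hx
      rcases hx with hx | hx
      · have := hqs x hx; omega
      · rw [List.mem_singleton.1 hx]
    · rw [SimpleGraph.Walk.support_concat, List.mem_append]
      exact Or.inl hv

theorem treedepth_le [Fintype V] (h : IsElimData G k Finset.univ r d) : treedepth G ≤ k := by
  have hacyc := h.forestGraph_isAcyclic
  let F : RootedForest V :=
    { graph := h.forestGraph
      isAcyclic := hacyc
      roots := {v | d v = 0}
      existsUnique_root := by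
        intro v
        obtain ⟨u, hu, huv⟩ := h.exists_root (Finset.mem_univ v)
        refine ⟨u, ⟨hu, h.reachable_of_reflTransGen huv⟩, ?_⟩
        rintro u' ⟨hu', hu'v⟩
        exact (h.eq_of_level_eq_zero (h.reflTransGen_of_reachable hu
          ((h.reachable_of_reflTransGen huv).trans hu'v.symm)) hu').symm }
  have hanc : ∀ u v, Relation.ReflTransGen r u v → F.IsAncestor u v := by
    intro u v huv
    obtain ⟨r₀, hr₀, hr₀u⟩ := h.exists_root (Finset.mem_univ u)
    obtain ⟨p, hp, hpl, hps, -⟩ := h.exists_path (SimpleGraph.Walk.nil (u := r₀))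
      SimpleGraph.Walk.IsPath.nil (by simp) (by simp) hr₀u
    obtain ⟨q, hq, -, -, hu⟩ := h.exists_path p hp hpl hps huv
    exact ⟨r₀, hr₀, q, hq, hu⟩
  have hF : F.IsEliminationForest G := fun u v huv =>
    (h.adj u (Finset.mem_univ u) v (Finset.mem_univ v) huv).imp (hanc u v) (hanc v u)
  have hle : treedepth G ≤ F.height := Nat.sInf_le ⟨F, hF, rfl⟩
  refine hle.trans (csSup_le' ?_)
  rintro n ⟨r₀, hr₀, l, -, p, hp, rfl⟩
  obtain ⟨q, hq, hql, -, -⟩ := h.exists_path (SimpleGraph.Walk.nil (u := r₀))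
    SimpleGraph.Walk.IsPath.nil (by simp) (by simp)
    (h.reflTransGen_of_reachable hr₀ p.reachable)
  have hpq : p = q := congrArg Subtype.val
    ((hacyc.subsingleton_path _ _).elim ⟨p, hp⟩ ⟨q, hq⟩)
  have h0 : d r₀ = 0 := hr₀
  have := h.lt l (Finset.mem_univ l)
  rw [hpq]
  omega

end IsElimData

/-! ### Separations and linked sweeps -/

/-- A separation of `G`, encoded as a pair `(C, A)` with `C ⊆ A` such that all neighbours of `C`
lie in `A`: no edge joins `C` to the complement of `A`. In the usual notation it is the separation
`(A, V \ C)`, whose separator is `A \ C`. -/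
def IsSeparation {V : Type*} (G : SimpleGraph V) (X : Finset V × Finset V) : Prop :=
  X.1 ⊆ X.2 ∧ ∀ u ∈ X.1, ∀ v, G.Adj u v → v ∈ X.2

/-- The separator `A \ C` of a separation `(C, A)`. -/
def separator {V : Type*} [DecidableEq V] (X : Finset V × Finset V) : Finset V := X.2 \ X.1

/-- The rank `|C| + |A|` of a pair `(C, A)` in the modular lattice of all pairs. -/
def pairRank {V : Type*} (X : Finset V × Finset V) : ℕ := X.1.card + X.2.card

/-- A sweep through `G` of width at most `a`: an increasing sequence of separations of order at
most `a` from the bottom to the top pair in which at most one vertex enters one of the two sets at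
each step. Steps that change nothing are allowed. -/
structure IsSweep {V : Type*} [Fintype V] [DecidableEq V] (G : SimpleGraph V) (a N : ℕ)
    (c : ℕ → Finset V × Finset V) : Prop where
  monotone : Monotone c
  zero : c 0 = ⊥
  top : c N = ⊤
  sep : ∀ l, IsSeparation G (c l)
  card_le : ∀ l, (separator (c l)).card ≤ a
  step : ∀ l, pairRank (c (l + 1)) ≤ pairRank (c l) + 1

/-- The sum of the orders of the separations of a sweep, in which repetitions do not count. -/
def sweepCost {V : Type*} [DecidableEq V] (N : ℕ) (c : ℕ → Finset V × Finset V) : ℕ :=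
  ∑ l ∈ Finset.range N, (separator (c (l + 1))).card * (pairRank (c (l + 1)) - pairRank (c l))

/-- A sweep is linked if no separation between two of its members has smaller order than all
members of the sweep between these two. -/
def IsLinkedSweep {V : Type*} [DecidableEq V] (G : SimpleGraph V)
    (c : ℕ → Finset V × Finset V) : Prop :=
  ∀ i j X, i ≤ j → IsSeparation G X → c i ≤ X → X ≤ c j →
    ∃ l, i ≤ l ∧ l ≤ j ∧ (separator (c l)).card ≤ (separator X).card

theorem pairRank_mono {V : Type*} : Monotone (pairRank (V := V)) := fun _ _ h =>
  Nat.add_le_add (Finset.card_le_card h.1) (Finset.card_le_card h.2)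

theorem eq_of_le_of_pairRank_le {V : Type*} {X Y : Finset V × Finset V} (h : X ≤ Y)
    (hr : pairRank Y ≤ pairRank X) : X = Y := by
  have h₁ := Finset.card_le_card h.1
  have h₂ := Finset.card_le_card h.2
  unfold pairRank at hr
  exact Prod.ext (Finset.eq_of_subset_of_card_le h.1 (by omega))
    (Finset.eq_of_subset_of_card_le h.2 (by omega))

section Separation

variable {V : Type*} [DecidableEq V] {G : SimpleGraph V} {X Y : Finset V × Finset V}

theorem IsSeparation.inf (hX : IsSeparation G X) (hY : IsSeparation G Y) :
    IsSeparation G (X ⊓ Y) :=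
  ⟨Finset.inter_subset_inter hX.1 hY.1, fun u hu v huv => Finset.mem_inter.2
    ⟨hX.2 u (Finset.mem_inter.1 hu).1 v huv, hY.2 u (Finset.mem_inter.1 hu).2 v huv⟩⟩

theorem IsSeparation.sup (hX : IsSeparation G X) (hY : IsSeparation G Y) :
    IsSeparation G (X ⊔ Y) :=
  ⟨Finset.union_subset_union hX.1 hY.1, fun u hu v huv => Finset.mem_union.2
    ((Finset.mem_union.1 hu).imp (fun h => hX.2 u h v huv) (fun h => hY.2 u h v huv))⟩

theorem IsSeparation.card_separator_add (hX : IsSeparation G X) :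
    (separator X).card + X.1.card = X.2.card :=
  Finset.card_sdiff_add_card_eq_card hX.1

theorem pairRank_inf_add_pairRank_sup (X Y : Finset V × Finset V) :
    pairRank (X ⊓ Y) + pairRank (X ⊔ Y) = pairRank X + pairRank Y := by
  have h₁ := Finset.card_inter_add_card_union X.1 Y.1
  have h₂ := Finset.card_inter_add_card_union X.2 Y.2
  change (X.1 ∩ Y.1).card + (X.2 ∩ Y.2).card + ((X.1 ∪ Y.1).card + (X.2 ∪ Y.2).card) =
    X.1.card + X.2.card + (Y.1.card + Y.2.card)
  omega

theorem IsSeparation.card_separator_inf_add_sup (hX : IsSeparation G X) (hY : IsSeparation G Y) :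
    (separator (X ⊓ Y)).card + (separator (X ⊔ Y)).card =
      (separator X).card + (separator Y).card := by
  have h₁ := Finset.card_inter_add_card_union X.1 Y.1
  have h₂ := Finset.card_inter_add_card_union X.2 Y.2
  have h₃ := (hX.inf hY).card_separator_add
  have h₄ := (hX.sup hY).card_separator_add
  have h₅ := hX.card_separator_add
  have h₆ := hY.card_separator_add
  change _ + (X.1 ∩ Y.1).card = (X.2 ∩ Y.2).card at h₃
  change _ + (X.1 ∪ Y.1).card = (X.2 ∪ Y.2).card at h₄
  omega

end Separation

section Sweep

variable {V : Type*} [Fintype V] [DecidableEq V] {G : SimpleGraph V} {a N : ℕ}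
  {c : ℕ → Finset V × Finset V}

/-- If a separation `X` has minimum order among the separations between two members of a sweep,
less than the order of every member between these two, then sweeping first the part below `X` and
then the part above `X` is cheaper. No order increases, because the order is modular and the
meets and joins with members in that range have order at least that of `X`. -/
theorem IsSweep.exists_sweepCost_lt (hc : IsSweep G a N c) {i j : ℕ} {X : Finset V × Finset V}
    (hij : i ≤ j) (hX : IsSeparation G X) (hiX : c i ≤ X) (hXj : X ≤ c j)
    (hlt : ∀ l, i ≤ l → l ≤ j → (separator X).card < (separator (c l)).card)
    (hmin : ∀ Y, IsSeparation G Y → c i ≤ Y → Y ≤ c j →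
      (separator X).card ≤ (separator Y).card) :
    ∃ N' d, IsSweep G a N' d ∧ sweepCost N' d < sweepCost N c := by
  have hinf : ∀ l, l ≤ j → (separator (c l ⊓ X)).card ≤ (separator (c l)).card := by
    intro l hl
    have h₁ := (hc.sep l).card_separator_inf_add_sup hX
    have h₂ := hmin _ ((hc.sep l).sup hX) (hiX.trans le_sup_right) (sup_le (hc.monotone hl) hXj)
    omega
  have hsup : ∀ l, i ≤ l → (separator (c l ⊔ X)).card ≤ (separator (c l)).card := by
    intro l hl
    have h₁ := (hc.sep l).card_separator_inf_add_sup hX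
    have h₂ := hmin _ ((hc.sep l).inf hX) (le_inf (hc.monotone hl) hiX) (inf_le_right.trans hXj)
    omega
  have hinf' : ∀ l, j ≤ l → c l ⊓ X = X := fun l hl =>
    inf_eq_right.2 (hXj.trans (hc.monotone hl))
  have hsup' : ∀ l, l ≤ i → c l ⊔ X = X := fun l hl =>
    sup_eq_right.2 ((hc.monotone hl).trans hiX)
  have hXa : (separator X).card ≤ a := (hlt i le_rfl hij).le.trans (hc.card_le i)
  have hr : ∀ l, pairRank (c l ⊓ X) + pairRank (c l ⊔ X) = pairRank (c l) + pairRank X :=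
    fun l => pairRank_inf_add_pairRank_sup _ _
  have hr₁ : ∀ l, pairRank (c l ⊓ X) ≤ pairRank (c (l + 1) ⊓ X) := fun l =>
    pairRank_mono (inf_le_inf_right X (hc.monotone (Nat.le_succ l)))
  have hr₂ : ∀ l, pairRank (c l ⊔ X) ≤ pairRank (c (l + 1) ⊔ X) := fun l =>
    pairRank_mono (sup_le_sup_right (hc.monotone (Nat.le_succ l)) X)
  let d : ℕ → Finset V × Finset V := fun l => if l ≤ N then c l ⊓ X else c (l - N) ⊔ X
  have hd₁ : ∀ l, l ≤ N → d l = c l ⊓ X := fun l hl => if_pos hl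
  have hd₂ : ∀ l, d (N + l) = c l ⊔ X := by
    intro l
    rcases Nat.eq_zero_or_pos l with rfl | hl
    · rw [hd₁ _ (by omega), Nat.add_zero, hc.top, hc.zero, top_inf_eq, bot_sup_eq]
    · have : ¬ N + l ≤ N := by omega
      simp only [d, if_neg this, Nat.add_sub_cancel_left]
  have hd : ∀ l, (l + 1 ≤ N ∧ d l = c l ⊓ X ∧ d (l + 1) = c (l + 1) ⊓ X) ∨
      ∃ m, d l = c m ⊔ X ∧ d (l + 1) = c (m + 1) ⊔ X := by
    intro l
    rcases Nat.lt_or_ge l N with hl | hl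
    · exact Or.inl ⟨hl, hd₁ l hl.le, hd₁ (l + 1) hl⟩
    · obtain ⟨m, rfl⟩ := Nat.exists_eq_add_of_le hl
      exact Or.inr ⟨m, hd₂ m, hd₂ (m + 1)⟩
  have hd' : ∀ l, ∃ m, d l = c m ⊓ X ∨ d l = c m ⊔ X := by
    intro l
    rcases hd l with ⟨-, h, -⟩ | ⟨m, h, -⟩
    · exact ⟨l, Or.inl h⟩
    · exact ⟨m, Or.inr h⟩
  refine ⟨N + N, d, ⟨?_, ?_, ?_, ?_, ?_, ?_⟩, ?_⟩
  · refine monotone_nat_of_le_succ fun l => ?_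
    rcases hd l with ⟨-, h₁, h₂⟩ | ⟨m, h₁, h₂⟩
    · rw [h₁, h₂]; exact inf_le_inf_right X (hc.monotone (Nat.le_succ l))
    · rw [h₁, h₂]; exact sup_le_sup_right (hc.monotone (Nat.le_succ m)) X
  · rw [hd₁ 0 (Nat.zero_le _), hc.zero, bot_inf_eq]
  · rw [hd₂, hc.top, top_sup_eq]
  · intro l
    obtain ⟨m, h | h⟩ := hd' l
    · rw [h]; exact (hc.sep m).inf hX
    · rw [h]; exact (hc.sep m).sup hX
  · intro l
    obtain ⟨m, h | h⟩ := hd' l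
    · rw [h]
      rcases le_total m j with hm | hm
      · exact (hinf m hm).trans (hc.card_le m)
      · rw [hinf' m hm]; exact hXa
    · rw [h]
      rcases le_total i m with hm | hm
      · exact (hsup m hm).trans (hc.card_le m)
      · rw [hsup' m hm]; exact hXa
  · intro l
    rcases hd l with ⟨-, h₁, h₂⟩ | ⟨m, h₁, h₂⟩
    · rw [h₁, h₂]
      have := hr l; have := hr (l + 1); have := hr₂ l; have := hc.step l
      omega
    · rw [h₁, h₂]
      have := hr m; have := hr (m + 1); have := hr₁ m; have := hc.step m
      omega
  · unfold sweepCost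
    rw [Finset.sum_range_add, ← Finset.sum_add_distrib]
    have hterm : ∀ l ∈ Finset.range N,
        (separator (d (l + 1))).card * (pairRank (d (l + 1)) - pairRank (d l)) +
          (separator (d (N + l + 1))).card * (pairRank (d (N + l + 1)) - pairRank (d (N + l))) =
        (separator (c (l + 1) ⊓ X)).card * (pairRank (c (l + 1) ⊓ X) - pairRank (c l ⊓ X)) +
          (separator (c (l + 1) ⊔ X)).card *
            (pairRank (c (l + 1) ⊔ X) - pairRank (c l ⊔ X)) := by
      intro l hl
      have hl := Finset.mem_range.1 hl
      rw [hd₁ l hl.le, hd₁ (l + 1) hl, hd₂ l, Nat.add_assoc, hd₂ (l + 1)]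
    have hsplit : ∀ l, pairRank (c (l + 1)) - pairRank (c l) =
        (pairRank (c (l + 1) ⊓ X) - pairRank (c l ⊓ X)) +
          (pairRank (c (l + 1) ⊔ X) - pairRank (c l ⊔ X)) := by
      intro l
      have := hr l; have := hr (l + 1); have := hr₁ l; have := hr₂ l
      omega
    have hupper : ∀ l, (separator (c (l + 1) ⊔ X)).card *
        (pairRank (c (l + 1) ⊔ X) - pairRank (c l ⊔ X)) ≤
        (separator (c (l + 1))).card * (pairRank (c (l + 1) ⊔ X) - pairRank (c l ⊔ X)) := by
      intro l
      rcases le_total i (l + 1) with hl | hl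
      · exact Nat.mul_le_mul_right _ (hsup _ hl)
      · rw [hsup' _ hl, hsup' l (by omega)]; simp
    rw [Finset.sum_congr rfl hterm]
    refine Finset.sum_lt_sum (fun l _ => ?_) ?_
    · rw [hsplit, mul_add]
      refine Nat.add_le_add ?_ (hupper l)
      rcases Nat.lt_or_ge l j with hl | hl
      · exact Nat.mul_le_mul_right _ (hinf _ hl)
      · rw [hinf' _ hl, hinf' (l + 1) (by omega)]; simp
    · -- The step at which the lower phase reaches `X` becomes strictly cheaper.
      have hex : ∃ m, X ≤ c m := ⟨j, hXj⟩
      classical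
      have hm := Nat.find_spec hex
      have hmj : Nat.find hex ≤ j := Nat.find_min' hex hXj
      have him : i < Nat.find hex := by
        by_contra hcon
        have hXi : X = c i := le_antisymm (hm.trans (hc.monotone (not_lt.1 hcon))) hiX
        have := hlt i le_rfl hij
        rw [hXi] at this
        exact lt_irrefl _ this
      obtain ⟨l, hl⟩ : ∃ l, Nat.find hex = l + 1 := ⟨Nat.find hex - 1, by omega⟩
      have hnot : ¬ X ≤ c l := Nat.find_min hex (by omega)
      rw [hl] at hm hmj him
      have hlN : l < N := by
        by_contra hcon
        apply hnot
        have : c N ≤ c l := hc.monotone (not_lt.1 hcon)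
        rw [hc.top] at this
        exact le_top.trans this
      refine ⟨l, Finset.mem_range.2 hlN, ?_⟩
      have hlX : c (l + 1) ⊓ X = X := inf_eq_right.2 hm
      have hpos : 0 < pairRank X - pairRank (c l ⊓ X) := by
        by_contra hcon
        exact hnot (inf_eq_right.1 (eq_of_le_of_pairRank_le inf_le_right (by omega)))
      rw [hsplit, mul_add, hlX]
      exact Nat.add_lt_add_of_lt_of_le
        (Nat.mul_lt_mul_of_pos_right (hlt _ him.le hmj) hpos) (hupper l)

/-- A sweep of minimum cost is linked. -/
theorem IsSweep.exists_isLinkedSweep (hc : IsSweep G a N c) :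
    ∃ N' d, IsSweep G a N' d ∧ IsLinkedSweep G d := by
  classical
  have hex : ∃ m N' d, IsSweep G a N' d ∧ sweepCost N' d = m := ⟨_, N, c, hc, rfl⟩
  obtain ⟨N', d, hd, hdm⟩ := Nat.find_spec hex
  refine ⟨N', d, hd, ?_⟩
  intro i j X hij hX hiX hXj
  by_contra! hcon
  have hex' : ∃ m Y, IsSeparation G Y ∧ d i ≤ Y ∧ Y ≤ d j ∧ (separator Y).card = m :=
    ⟨_, X, hX, hiX, hXj, rfl⟩
  obtain ⟨Y, hY, hiY, hYj, hYm⟩ := Nat.find_spec hex'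
  have hmin : ∀ Z, IsSeparation G Z → d i ≤ Z → Z ≤ d j →
      (separator Y).card ≤ (separator Z).card := fun Z hZ hiZ hZj =>
    hYm.le.trans (Nat.find_min' hex' ⟨Z, hZ, hiZ, hZj, rfl⟩)
  obtain ⟨N'', d', hd', hlt⟩ := hd.exists_sweepCost_lt hij hY hiY hYj
    (fun l hil hlj => (hmin X hX hiX hXj).trans_lt (hcon l hil hlj)) hmin
  rw [hdm] at hlt
  exact Nat.find_min hex hlt ⟨N'', d', hd', rfl⟩

/-- A path decomposition yields a sweep: every vertex enters when its first bag is reached and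
leaves after its last bag, all at different times. -/
theorem PathDecomposition.exists_isSweep {n : ℕ} (D : PathDecomposition G n)
    (ha : ∀ t, (D.bag t).card ≤ a) : ∃ N c, IsSweep G a N c := by
  classical
  let M := Fintype.card V
  let e : V ≃ Fin M := Fintype.equivFin V
  have hfirst : ∀ v, ∃ s : Fin (n + 1), v ∈ D.bag s ∧ ∀ t, v ∈ D.bag t → s ≤ t := by
    intro v
    obtain ⟨t, ht⟩ := D.nonempty_nodes v
    have hne : (Finset.univ.filter fun t => v ∈ D.bag t).Nonempty :=
      ⟨t, Finset.mem_filter.2 ⟨Finset.mem_univ _, ht⟩⟩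
    have hmem := Finset.min'_mem _ hne
    refine ⟨_, (Finset.mem_filter.1 hmem).2, fun t ht => Finset.min'_le _ t ?_⟩
    exact Finset.mem_filter.2 ⟨Finset.mem_univ _, ht⟩
  have hlast : ∀ v, ∃ s : Fin (n + 1), v ∈ D.bag s ∧ ∀ t, v ∈ D.bag t → t ≤ s := by
    intro v
    obtain ⟨t, ht⟩ := D.nonempty_nodes v
    have hne : (Finset.univ.filter fun t => v ∈ D.bag t).Nonempty :=
      ⟨t, Finset.mem_filter.2 ⟨Finset.mem_univ _, ht⟩⟩
    have hmem := Finset.max'_mem _ hne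
    refine ⟨_, (Finset.mem_filter.1 hmem).2, fun t ht => Finset.le_max' _ t ?_⟩
    exact Finset.mem_filter.2 ⟨Finset.mem_univ _, ht⟩
  choose first hfirst_mem hfirst_le using hfirst
  choose last hlast_mem hlast_le using hlast
  let enter : V → ℕ := fun v => 2 * M * (first v : ℕ) + e v
  let leave : V → ℕ := fun v => 2 * M * (last v : ℕ) + M + e v
  have heM : ∀ v, (e v : ℕ) < M := fun v => (e v).2
  have hdiv : ∀ {s t x y : ℕ}, x < 2 * M → y < 2 * M → 2 * M * s + x = 2 * M * t + y →
      s = t ∧ x = y := by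
    intro s t x y hx hy h
    have hst : s = t := by
      have h₁ := congrArg (· / (2 * M)) h
      simp only [Nat.mul_add_div (by omega : 2 * M > 0), Nat.div_eq_of_lt hx,
        Nat.div_eq_of_lt hy] at h₁
      omega
    subst hst
    exact ⟨rfl, by omega⟩
  have hinj : ∀ u v, (e u : ℕ) = e v → u = v := fun u v h => e.injective (Fin.ext h)
  have henter : ∀ u v, enter u = enter v → u = v := by
    intro u v h
    have := heM u; have := heM v
    exact hinj u v (hdiv (by omega) (by omega) h).2
  have hleave : ∀ u v, leave u = leave v → u = v := by
    intro u v h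
    have := heM u; have := heM v
    simp only [leave, Nat.add_assoc] at h
    have := (hdiv (by omega) (by omega) h).2
    exact hinj u v (by omega)
  have hne : ∀ u v, leave u ≠ enter v := by
    intro u v h
    have := heM u; have := heM v
    simp only [leave, enter, Nat.add_assoc] at h
    have := (hdiv (by omega) (by omega) h).2
    omega
  have hle : ∀ {u v s}, u ∈ D.bag s → v ∈ D.bag s → enter v < leave u := by
    intro u v s hu hv
    have h₁ : (first v : ℕ) ≤ last u := (hfirst_le v s hv).trans (hlast_le u s hu)
    have h₂ := Nat.mul_le_mul_left (2 * M) h₁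
    have := heM u; have := heM v
    simp only [leave, enter]
    omega
  let c : ℕ → Finset V × Finset V := fun l =>
    (Finset.univ.filter fun v => leave v < l, Finset.univ.filter fun v => enter v < l)
  have hc₁ : ∀ l v, v ∈ (c l).1 ↔ leave v < l := fun l v => by simp [c]
  have hc₂ : ∀ l v, v ∈ (c l).2 ↔ enter v < l := fun l v => by simp [c]
  have hself : ∀ v, enter v < leave v := fun v => hle (hfirst_mem v) (hfirst_mem v)
  have hbound : ∀ v, leave v < 2 * M * (n + 1) := by
    intro v
    have h₁ : (last v : ℕ) + 1 ≤ n + 1 := (last v).2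
    have h₂ := Nat.mul_le_mul_left (2 * M) h₁
    have := heM v
    simp only [leave]
    rw [Nat.mul_add] at h₂
    omega
  refine ⟨2 * M * (n + 1), c, ⟨?_, ?_, ?_, ?_, ?_, ?_⟩⟩
  · intro l m hlm
    exact ⟨fun v hv => (hc₁ m v).2 (((hc₁ l v).1 hv).trans_le hlm),
      fun v hv => (hc₂ m v).2 (((hc₂ l v).1 hv).trans_le hlm)⟩
  · refine Prod.ext ?_ ?_
    · exact Finset.eq_empty_of_forall_notMem fun v hv => by simpa using (hc₁ 0 v).1 hv
    · exact Finset.eq_empty_of_forall_notMem fun v hv => by simpa using (hc₂ 0 v).1 hv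
  · refine Prod.ext ?_ ?_
    · exact Finset.eq_univ_of_forall fun v => (hc₁ _ v).2 (hbound v)
    · exact Finset.eq_univ_of_forall fun v => (hc₂ _ v).2 ((hself v).trans (hbound v))
  · intro l
    refine ⟨fun v hv => (hc₂ l v).2 ((hself v).trans ((hc₁ l v).1 hv)), fun u hu v huv => ?_⟩
    obtain ⟨s, hus, hvs⟩ := D.exists_bag_of_adj u v huv
    exact (hc₂ l v).2 ((hle hus hvs).trans ((hc₁ l u).1 hu))
  · intro l
    -- The vertices that have entered but not left lie in the bag of the current round.
    rcases Finset.eq_empty_or_nonempty (separator (c l)) with h0 | ⟨w, hw⟩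
    · rw [h0]; simp
    have hmem : ∀ v, v ∈ separator (c l) ↔ enter v < l ∧ l ≤ leave v := by
      intro v
      rw [separator, Finset.mem_sdiff, hc₁, hc₂, not_lt]
    have hM : 0 < 2 * M := by have := heM w; omega
    have hln : l / (2 * M) < n + 1 :=
      (Nat.div_lt_iff_lt_mul hM).2 (by
        have := hbound w; have := ((hmem w).1 hw).2; rw [Nat.mul_comm (n + 1)]; omega)
    refine (Finset.card_le_card ?_).trans (ha ⟨l / (2 * M), hln⟩)
    intro v hv
    obtain ⟨h₁, h₂⟩ := (hmem v).1 hv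
    have h₃ : (first v : ℕ) ≤ l / (2 * M) := by
      rw [Nat.le_div_iff_mul_le hM, Nat.mul_comm]
      simp only [enter] at h₁
      omega
    have h₄ : l / (2 * M) ≤ last v := by
      refine Nat.le_of_lt_succ ((Nat.div_lt_iff_lt_mul hM).2 ?_)
      have := heM v
      simp only [leave] at h₂
      rw [Nat.succ_mul, Nat.mul_comm]
      omega
    exact (D.ordConnected_nodes v).out (hfirst_mem v) (hlast_mem v) ⟨h₃, h₄⟩
  · intro l
    have hkeep : ∀ {f : V → ℕ}, (∀ v, f v ≠ l) →
        ∀ v, f v < l + 1 → f v < l := fun hf v hv =>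
      lt_of_le_of_ne (Nat.le_of_lt_succ hv) (hf v)
    have hadd : ∀ {f : V → ℕ} {u}, (∀ u v, f u = f v → u = v) → f u = l →
        ∀ v, f v < l + 1 → v = u ∨ f v < l := by
      intro f u hf hu v hv
      rcases (Nat.le_of_lt_succ hv).lt_or_eq with h | h
      · exact Or.inr h
      · exact Or.inl (hf v u (h.trans hu.symm))
    unfold pairRank
    by_cases h₁ : ∃ u, leave u = l
    · obtain ⟨u, hu⟩ := h₁
      have h₁ : (c (l + 1)).1 ⊆ insert u (c l).1 := fun v hv =>
        Finset.mem_insert.2 ((hadd hleave hu v ((hc₁ _ v).1 hv)).imp_right (hc₁ l v).2)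
      have h₂ : (c (l + 1)).2 ⊆ (c l).2 := fun v hv => (hc₂ l v).2
        (hkeep (fun w hw => hne u w (hu.trans hw.symm)) v ((hc₂ _ v).1 hv))
      have := Finset.card_le_card h₁
      have := Finset.card_le_card h₂
      have := Finset.card_insert_le u (c l).1
      omega
    · have h₁ : (c (l + 1)).1 ⊆ (c l).1 := fun v hv => (hc₁ l v).2
        (hkeep (fun w hw => h₁ ⟨w, hw⟩) v ((hc₁ _ v).1 hv))
      have := Finset.card_le_card h₁
      by_cases h₂ : ∃ u, enter u = l
      · obtain ⟨u, hu⟩ := h₂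
        have h₂ : (c (l + 1)).2 ⊆ insert u (c l).2 := fun v hv =>
          Finset.mem_insert.2 ((hadd henter hu v ((hc₂ _ v).1 hv)).imp_right (hc₂ l v).2)
        have := Finset.card_le_card h₂
        have := Finset.card_insert_le u (c l).2
        omega
      · have h₂ : (c (l + 1)).2 ⊆ (c l).2 := fun v hv => (hc₂ l v).2
          (hkeep (fun w hw => h₂ ⟨w, hw⟩) v ((hc₂ _ v).1 hv))
        have := Finset.card_le_card h₂
        omega

end Sweep

/-! ### Disjoint paths between separators -/

/-- A family of pairwise disjoint paths of `G` from `S` to `T`, labelled by the elements of `F`: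
the path with label `s` has length `e s` and visits `P s 0, …, P s (e s)` in this order. The label
carries no information; values of `P s` beyond `e s` are irrelevant. -/
structure IsLinkage {V : Type*} (G : SimpleGraph V) (S T F : Finset V) (e : V → ℕ)
    (P : V → ℕ → V) : Prop where
  start_mem : ∀ s ∈ F, P s 0 ∈ S
  finish_mem : ∀ s ∈ F, P s (e s) ∈ T
  adj : ∀ s ∈ F, ∀ t < e s, G.Adj (P s t) (P s (t + 1))
  inj : ∀ s ∈ F, ∀ s' ∈ F, ∀ t ≤ e s, ∀ t' ≤ e s', P s t = P s' t' → s = s' ∧ t = t'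

section Linkage

variable {V : Type*} {G : SimpleGraph V} {S T F : Finset V} {e : V → ℕ}
  {P : V → ℕ → V}

theorem IsLinkage.card_le (h : IsLinkage G S T F e P) : F.card ≤ S.card :=
  Finset.card_le_card_of_injOn (fun s => P s 0) (fun s hs => h.start_mem s hs)
    fun s hs s' hs' heq => (h.inj s hs s' hs' 0 (Nat.zero_le _) 0 (Nat.zero_le _) heq).1

theorem IsLinkage.lt_of_not_isContained (h : IsLinkage G S T F e P) {n : ℕ}
    (hG : ¬ (SimpleGraph.pathGraph n).IsContained G) {s : V} (hs : s ∈ F) : e s + 1 < n := by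
  by_contra! hcon
  refine hG ⟨⟨⟨fun i => P s i, ?_⟩, ?_⟩⟩
  · intro i j hij
    have hi := i.2
    have hj := j.2
    rcases SimpleGraph.pathGraph_adj.1 hij with hij | hij
    · rw [← hij]; exact h.adj s hs i (by omega)
    · rw [← hij]; exact (h.adj s hs j (by omega)).symm
  · intro i j hij
    have hi := i.2
    have hj := j.2
    exact Fin.ext (h.inj s hs s hs i (by omega) j (by omega) hij).2

/-- The vertices at which an injective partial map is iterated from outside its image are all
different. -/
theorem iterate_inj_of_injective_off {V : Type*} {g : V → V} {S : Finset V} {halt : V → Prop}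
    (hinj : ∀ u v, ¬ halt u → ¬ halt v → g u = g v → u = v) (hS : ∀ v, ¬ halt v → g v ∉ S) :
    ∀ (t : ℕ) {s : V}, s ∈ S → (∀ r < t, ¬ halt (g^[r] s)) → ∀ (t' : ℕ) {s' : V}, s' ∈ S →
      (∀ r < t', ¬ halt (g^[r] s')) → g^[t] s = g^[t'] s' → s = s' ∧ t = t' := by
  intro t
  induction t with
  | zero =>
    intro s hs _ t' s' hs' hst' heq
    cases t' with
    | zero => exact ⟨heq, rfl⟩
    | succ t' =>
      rw [Function.iterate_succ_apply'] at heq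
      exact absurd (heq ▸ hs) (hS _ (hst' t' (Nat.lt_succ_self _)))
  | succ t ih =>
    intro s hs hst t' s' hs' hst' heq
    cases t' with
    | zero =>
      rw [Function.iterate_succ_apply'] at heq
      exact absurd (heq ▸ hs') (hS _ (hst t (Nat.lt_succ_self _)))
    | succ t' =>
      rw [Function.iterate_succ_apply', Function.iterate_succ_apply'] at heq
      obtain ⟨h₁, h₂⟩ := ih hs (fun r hr => hst r (Nat.lt_succ_of_lt hr)) t' hs'
        (fun r hr => hst' r (Nat.lt_succ_of_lt hr))
        (hinj _ _ (hst t (Nat.lt_succ_self _)) (hst' t' (Nat.lt_succ_self _)) heq)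
      exact ⟨h₁, by rw [h₂]⟩

variable [DecidableEq V]

/-- A form of Menger's theorem, obtained from Hall's theorem. The hypothesis bounds from below the
separators `(S \ W) ∪ (N(W) \ W)` between `S` and `T`. Hall's theorem gives an injection that maps
every vertex `v ∉ T` to `v`, to a neighbour of `v` outside `S`, or to one of `|S| - k` dummy
elements. Iterating it from the vertices of `S` produces disjoint paths, of which at most
`|S| - k` run into a dummy and the others end in `T`. Vertices of `S ∩ T` become trivial paths. -/
theorem exists_isLinkage_of_card_le [Fintype V] (S T : Finset V) (k : ℕ)
    (h : ∀ W N : Finset V, Disjoint W T → (∀ v, v ∈ N ↔ ∃ u ∈ W, G.Adj u v) →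
      k ≤ (S \ W).card + ((N \ W) \ S).card) :
    ∃ F e P, IsLinkage G S T F e P ∧ k ≤ F.card ∧
      (F.filter fun s => e s ≠ 0).card + (S ∩ T).card ≤ F.card := by
  classical
  have hkS : k ≤ S.card := by simpa using h ∅ ∅ (by simp) (by simp)
  let nb : V → Finset V := fun v => Finset.univ.filter fun w => G.Adj v w
  have hnb : ∀ v w, w ∈ nb v ↔ G.Adj v w := fun v w => by simp [nb]
  let opt : {v : V // v ∉ T} → Finset (V ⊕ Fin (S.card - k)) := fun v =>
    (insert (v : V) (nb v) \ S).disjSum Finset.univ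
  have hall : ∀ W : Finset {v : V // v ∉ T}, W.card ≤ (W.biUnion opt).card := by
    intro W
    rcases W.eq_empty_or_nonempty with rfl | ⟨w₀, hw₀⟩
    · simp
    let W' : Finset V := W.map (Function.Embedding.subtype _)
    have hW' : ∀ v, v ∈ W' ↔ ∃ w ∈ W, (w : V) = v := fun v => by simp [W']
    let N : Finset V := Finset.univ.filter fun v => ∃ u ∈ W', G.Adj u v
    have hN : ∀ v, v ∈ N ↔ ∃ u ∈ W', G.Adj u v := fun v => by simp [N]
    have hdisj : Disjoint W' T := Finset.disjoint_left.2 fun v hv => by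
      obtain ⟨w, -, rfl⟩ := (hW' v).1 hv
      exact w.2
    have hk := h W' N hdisj hN
    have hsub : ((W' ∪ N) \ S).disjSum (Finset.univ : Finset (Fin (S.card - k))) ⊆
        W.biUnion opt := by
      intro x hx
      rw [Finset.mem_biUnion]
      rcases Finset.mem_disjSum.1 hx with ⟨v, hv, rfl⟩ | ⟨i, -, rfl⟩
      · obtain ⟨hv, hvS⟩ := Finset.mem_sdiff.1 hv
        rcases Finset.mem_union.1 hv with hv | hv
        · obtain ⟨w, hw, rfl⟩ := (hW' v).1 hv
          exact ⟨w, hw, Finset.inl_mem_disjSum.2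
            (Finset.mem_sdiff.2 ⟨Finset.mem_insert_self _ _, hvS⟩)⟩
        · obtain ⟨u, hu, huv⟩ := (hN v).1 hv
          obtain ⟨w, hw, rfl⟩ := (hW' u).1 hu
          exact ⟨w, hw, Finset.inl_mem_disjSum.2 (Finset.mem_sdiff.2
            ⟨Finset.mem_insert_of_mem ((hnb _ _).2 huv), hvS⟩)⟩
      · exact ⟨w₀, hw₀, Finset.inr_mem_disjSum.2 (Finset.mem_univ _)⟩
    have h₁ := Finset.card_le_card hsub
    rw [Finset.card_disjSum, Finset.card_univ, Fintype.card_fin] at h₁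
    have h₂ : ((W' ∪ N) \ S).card = (W' \ S).card + ((N \ W') \ S).card := by
      rw [← Finset.card_union_of_disjoint]
      · congr 1
        ext v
        simp only [Finset.mem_sdiff, Finset.mem_union]
        tauto
      · rw [Finset.disjoint_left]
        intro v hv hv'
        exact (Finset.mem_sdiff.1 (Finset.mem_sdiff.1 hv').1).2 (Finset.mem_sdiff.1 hv).1
    have h₃ : (W' \ S).card + (W' ∩ S).card = W'.card := Finset.card_sdiff_add_card_inter _ _
    have h₄ : (S \ W').card + (S ∩ W').card = S.card := Finset.card_sdiff_add_card_inter _ _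
    have h₅ : W'.card = W.card := Finset.card_map _
    rw [Finset.inter_comm] at h₄
    omega
  obtain ⟨σ, hσ, hσmem⟩ := (Finset.all_card_le_biUnion_card_iff_exists_injective opt).1 hall
  -- `halt v`: the iteration cannot be continued at `v`.
  let halt : V → Prop := fun v => ∀ (hv : v ∉ T) (w : V), σ ⟨v, hv⟩ ≠ Sum.inl w
  have hgo : ∀ v, ∃ w, ¬ halt v → ∃ hv : v ∉ T, σ ⟨v, hv⟩ = Sum.inl w := by
    intro v
    by_cases hv : halt v
    · exact ⟨v, fun h => absurd hv h⟩
    · simp only [halt, not_forall, not_not] at hv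
      obtain ⟨hvT, w, hw⟩ := hv
      exact ⟨w, fun _ => ⟨hvT, hw⟩⟩
  choose g hg using hgo
  have hginj : ∀ u v, ¬ halt u → ¬ halt v → g u = g v → u = v := by
    intro u v hu hv huv
    obtain ⟨hu', h₁⟩ := hg u hu
    obtain ⟨hv', h₂⟩ := hg v hv
    rw [huv, ← h₂] at h₁
    exact congrArg Subtype.val (hσ h₁)
  have hgmem : ∀ v, ¬ halt v → g v ∉ S ∧ (g v = v ∨ G.Adj v (g v)) := by
    intro v hv
    obtain ⟨hv', h₁⟩ := hg v hv
    have h₂ := hσmem ⟨v, hv'⟩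
    rw [h₁, Finset.inl_mem_disjSum, Finset.mem_sdiff, Finset.mem_insert, hnb] at h₂
    exact ⟨h₂.2, h₂.1⟩
  have hkey := iterate_inj_of_injective_off (g := g) (S := S) (halt := halt) hginj
    fun v hv => (hgmem v hv).1
  have hhalt : ∀ s ∈ S, ∃ t, halt (g^[t] s) := by
    intro s hs
    by_contra! hcon
    exact not_injective_infinite_finite (fun t : ℕ => g^[t] s) fun t t' htt' =>
      (hkey t hs (fun r _ => hcon r) t' hs (fun r _ => hcon r) htt').2
  let e : V → ℕ := fun s => if hs : ∃ t, halt (g^[t] s) then Nat.find hs else 0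
  have he : ∀ s ∈ S, halt (g^[e s] s) ∧ ∀ r < e s, ¬ halt (g^[r] s) := by
    intro s hs
    have hes : e s = Nat.find (hhalt s hs) := dif_pos (hhalt s hs)
    rw [hes]
    exact ⟨Nat.find_spec (hhalt s hs), fun r hr => Nat.find_min (hhalt s hs) hr⟩
  have hST : S ∩ T ⊆ S.filter fun s => g^[e s] s ∈ T ∧ e s = 0 := by
    intro s hs
    obtain ⟨hs, hsT⟩ := Finset.mem_inter.1 hs
    have h0 : e s = 0 := by
      by_contra hne
      have := (he s hs).2 0 (Nat.pos_of_ne_zero hne)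
      exact this fun hv => absurd hsT hv
    exact Finset.mem_filter.2 ⟨hs, by rw [h0]; exact hsT, h0⟩
  refine ⟨S.filter fun s => g^[e s] s ∈ T, e, fun s t => g^[t] s, ⟨?_, ?_, ?_, ?_⟩, ?_, ?_⟩
  · intro s hs
    exact (Finset.mem_filter.1 hs).1
  · intro s hs
    exact (Finset.mem_filter.1 hs).2
  · intro s hs t ht
    have hsS := (Finset.mem_filter.1 hs).1
    have hns := (he s hsS).2
    simp only [Function.iterate_succ_apply']
    rcases (hgmem _ (hns t ht)).2 with heq | hadj
    · rw [← Function.iterate_succ_apply' g] at heq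
      have := (hkey (t + 1) hsS (fun r hr => hns r (by omega)) t hsS
        (fun r hr => hns r (by omega)) heq).2
      omega
    · exact hadj
  · intro s hs s' hs' t ht t' ht' heq
    have hsS := (Finset.mem_filter.1 hs).1
    have hsS' := (Finset.mem_filter.1 hs').1
    exact hkey t hsS (fun r hr => (he s hsS).2 r (by omega)) t' hsS'
      (fun r hr => (he s' hsS').2 r (by omega)) heq
  · have hle : (S.filter fun s => ¬ g^[e s] s ∈ T).card ≤
        ((∅ : Finset V).disjSum (Finset.univ : Finset (Fin (S.card - k)))).card := by
      refine Finset.card_le_card_of_injOn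
        (fun s => if hv : g^[e s] s ∉ T then σ ⟨_, hv⟩ else Sum.inl s) ?_ ?_
      · intro s hs
        obtain ⟨hsS, hsT⟩ := Finset.mem_filter.1 hs
        simp only [dif_pos hsT]
        rcases hσs : σ ⟨_, hsT⟩ with w | i
        · exact absurd hσs ((he s hsS).1 hsT w)
        · exact Finset.mem_coe.2 (Finset.inr_mem_disjSum.2 (Finset.mem_univ i))
      · intro s hs s' hs' heq
        obtain ⟨hsS, hsT⟩ := Finset.mem_filter.1 hs
        obtain ⟨hsS', hsT'⟩ := Finset.mem_filter.1 hs'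
        simp only [dif_pos hsT, dif_pos hsT'] at heq
        exact (hkey (e s) hsS (he s hsS).2 (e s') hsS' (he s' hsS').2
          (congrArg Subtype.val (hσ heq))).1
    rw [Finset.card_disjSum, Finset.card_empty, Finset.card_univ, Fintype.card_fin] at hle
    have := Finset.card_filter_add_card_filter_not (s := S) (fun s => g^[e s] s ∈ T)
    omega
  · rw [← Finset.card_union_of_disjoint]
    · refine Finset.card_le_card (Finset.union_subset (Finset.filter_subset _ _) fun s hs => ?_)
      have := Finset.mem_filter.1 (hST hs)
      exact Finset.mem_filter.2 ⟨this.1, this.2.1⟩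
    · rw [Finset.disjoint_left]
      intro s hs hs'
      exact (Finset.mem_filter.1 hs).2 (Finset.mem_filter.1 (hST hs')).2.2

/-- If all separations between `X` and `Y` have order at least `k`, then there are at least `k`
disjoint paths between their separators, and all common vertices of the separators are among the
trivial paths. -/
theorem exists_isLinkage_separator [Fintype V] {X Y : Finset V × Finset V} {k : ℕ}
    (hX : IsSeparation G X) (hY : IsSeparation G Y) (hXY : X ≤ Y)
    (h : ∀ Z, IsSeparation G Z → X ≤ Z → Z ≤ Y → k ≤ (separator Z).card) :
    ∃ F e P, IsLinkage G (separator X) (separator Y) F e P ∧ k ≤ F.card ∧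
      (F.filter fun s => e s ≠ 0).card + (separator X ∩ separator Y).card ≤ F.card := by
  classical
  refine exists_isLinkage_of_card_le _ _ _ fun W N hW hN => ?_
  have hWY : ∀ v ∈ W, v ∈ Y.2 → v ∈ Y.1 := by
    intro v hv hvY
    by_contra hcon
    exact Finset.disjoint_left.1 hW hv (Finset.mem_sdiff.2 ⟨hvY, hcon⟩)
  -- The separation whose small side consists of `C_X` and the part of `W` inside `C_Y`.
  let Z : Finset V × Finset V :=
    (X.1 ∪ (W ∩ Y.1), X.2 ∪ (W ∩ Y.1) ∪ Y.2.filter fun v => ∃ u ∈ W ∩ Y.1, G.Adj u v)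
  have hZ : IsSeparation G Z := by
    refine ⟨fun v hv => Finset.mem_union_left _ ?_, fun u hu v huv => ?_⟩
    · exact Finset.mem_union.2 ((Finset.mem_union.1 hv).imp_left fun h => hX.1 h)
    · rcases Finset.mem_union.1 hu with hu | hu
      · exact Finset.mem_union_left _ (Finset.mem_union_left _ (hX.2 u hu v huv))
      · exact Finset.mem_union_right _ (Finset.mem_filter.2
          ⟨hY.2 u (Finset.mem_inter.1 hu).2 v huv, u, hu, huv⟩)
  have hXZ : X ≤ Z := ⟨Finset.subset_union_left,
    Finset.subset_union_left.trans Finset.subset_union_left⟩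
  have hZY : Z ≤ Y := ⟨Finset.union_subset hXY.1 Finset.inter_subset_right,
    Finset.union_subset (Finset.union_subset hXY.2 (Finset.inter_subset_right.trans hY.1))
      (Finset.filter_subset _ _)⟩
  refine (h Z hZ hXZ hZY).trans ((Finset.card_le_card ?_).trans (Finset.card_union_le _ _))
  intro v hv
  obtain ⟨hv₂, hv₁⟩ := Finset.mem_sdiff.1 hv
  have hvX : v ∉ X.1 := fun h => hv₁ (Finset.mem_union_left _ h)
  have hvW : v ∈ Y.2 → v ∉ W := fun hvY hvW =>
    hv₁ (Finset.mem_union_right _ (Finset.mem_inter.2 ⟨hvW, hWY v hvW hvY⟩))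
  have hvW := hvW (hZY.2 hv₂)
  by_cases hvX₂ : v ∈ X.2
  · exact Finset.mem_union_left _ (Finset.mem_sdiff.2 ⟨Finset.mem_sdiff.2 ⟨hvX₂, hvX⟩, hvW⟩)
  · refine Finset.mem_union_right _ (Finset.mem_sdiff.2 ⟨Finset.mem_sdiff.2 ⟨?_, hvW⟩,
      fun h => hvX₂ (Finset.mem_sdiff.1 h).1⟩)
    rcases Finset.mem_union.1 hv₂ with hv₂ | hv₂
    · rcases Finset.mem_union.1 hv₂ with hv₂ | hv₂
      · exact absurd hv₂ hvX₂
      · exact absurd (Finset.mem_inter.1 hv₂).1 hvW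
    · obtain ⟨-, u, hu, huv⟩ := Finset.mem_filter.1 hv₂
      exact (hN v).2 ⟨u, (Finset.mem_inter.1 hu).1, huv⟩

/-- A linkage from `X` to `Y` is cut at a separation `L` between them: every path splits at its
first vertex in the separator of `L`. A path that splits at one of its own ends contributes to
that separator a vertex that does not lie strictly between `X` and `Y`. -/
theorem IsLinkage.exists_split {X L Y : Finset V × Finset V}
    (h : IsLinkage G (separator X) (separator Y) F e P) (hL : IsSeparation G L)
    (hXL : X ≤ L) (hLY : L ≤ Y) :
    ∃ x : V → ℕ, (∀ s ∈ F, x s ≤ e s) ∧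
      IsLinkage G (separator X) (separator L) F x P ∧
      IsLinkage G (separator L) (separator Y) F (fun s => e s - x s) (fun s t => P s (x s + t)) ∧
      (separator L ∩ (Y.1 \ X.2)).card + (F.filter fun s => x s = 0 ∨ x s = e s).card ≤
        (separator L).card := by
  classical
  have hend : ∀ s ∈ F, P s (e s) ∉ L.1 := fun s hs hmem =>
    (Finset.mem_sdiff.1 (h.finish_mem s hs)).2 (hLY.1 hmem)
  have hstart : ∀ s ∈ F, P s 0 ∈ L.2 := fun s hs =>
    hXL.2 (Finset.mem_sdiff.1 (h.start_mem s hs)).1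
  have hx : ∀ s ∈ F, ∃ t, t ≤ e s ∧ P s t ∈ separator L := by
    intro s hs
    have hex : ∃ t, P s t ∉ L.1 := ⟨e s, hend s hs⟩
    have hle := Nat.find_min' hex (hend s hs)
    refine ⟨Nat.find hex, hle, Finset.mem_sdiff.2 ⟨?_, Nat.find_spec hex⟩⟩
    rcases hm : Nat.find hex with _ | m
    · exact hstart s hs
    · have hmem : P s m ∈ L.1 := not_not.1 (Nat.find_min hex (m := m) (by omega))
      exact hL.2 _ hmem _ (h.adj s hs m (by omega))
  choose! x hxe hxL using hx
  refine ⟨x, hxe, ⟨h.start_mem, hxL, ?_, ?_⟩, ⟨hxL, ?_, ?_, ?_⟩, ?_⟩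
  · intro s hs t ht
    have := hxe s hs
    exact h.adj s hs t (by omega)
  · intro s hs s' hs' t ht t' ht'
    have := hxe s hs
    have := hxe s' hs'
    exact h.inj s hs s' hs' t (by omega) t' (by omega)
  · intro s hs
    simp only [Nat.add_sub_cancel' (hxe s hs)]
    exact h.finish_mem s hs
  · intro s hs t ht
    have := hxe s hs
    exact h.adj s hs (x s + t) (by omega)
  · intro s hs s' hs' t ht t' ht' heq
    have := hxe s hs
    have := hxe s' hs'
    obtain ⟨rfl, h₃⟩ := h.inj s hs s' hs' (x s + t) (by omega) (x s' + t') (by omega) heq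
    exact ⟨rfl, by omega⟩
  · have hle : (F.filter fun s => x s = 0 ∨ x s = e s).card ≤
        (separator L \ (Y.1 \ X.2)).card := by
      refine Finset.card_le_card_of_injOn (fun s => if x s = 0 then P s 0 else P s (e s)) ?_ ?_
      · intro s hs
        obtain ⟨hs, hor⟩ := Finset.mem_filter.1 hs
        have h₃ := hxL s hs
        rw [Finset.mem_coe, Finset.mem_sdiff, Finset.mem_sdiff]
        by_cases h0 : x s = 0
        · simp only [if_pos h0]
          rw [h0] at h₃
          exact ⟨h₃, fun hcon => hcon.2 (Finset.mem_sdiff.1 (h.start_mem s hs)).1⟩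
        · simp only [if_neg h0]
          rw [hor.resolve_left h0] at h₃
          exact ⟨h₃, fun hcon => (Finset.mem_sdiff.1 (h.finish_mem s hs)).2 hcon.1⟩
      · intro s hs s' hs' heq
        have hs := (Finset.mem_filter.1 hs).1
        have hs' := (Finset.mem_filter.1 hs').1
        have key : ∀ t ≤ e s, ∀ t' ≤ e s', P s t = P s' t' → s = s' := fun t ht t' ht' hP =>
          (h.inj s hs s' hs' t ht t' ht' hP).1
        simp only at heq
        split_ifs at heq
        · exact key _ (Nat.zero_le _) _ (Nat.zero_le _) heq
        · exact key _ (Nat.zero_le _) _ le_rfl heq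
        · exact key _ le_rfl _ (Nat.zero_le _) heq
        · exact key _ le_rfl _ le_rfl heq
    have := Finset.card_sdiff_add_card_inter (separator L) (Y.1 \ X.2)
    omega

end Linkage

/-! ### Weights of paths -/

/-- The weight of a path with `e` edges: `0` for a trivial path and `1 + log₂ e` otherwise. -/
noncomputable def pathWeight (e : ℕ) : ℝ := if e = 0 then 0 else 1 + Real.logb 2 e

theorem pathWeight_zero : pathWeight 0 = 0 := if_pos rfl

theorem pathWeight_of_ne_zero {e : ℕ} (he : e ≠ 0) : pathWeight e = 1 + Real.logb 2 e := if_neg he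

theorem one_le_pathWeight {e : ℕ} (he : e ≠ 0) : 1 ≤ pathWeight e := by
  rw [pathWeight_of_ne_zero he]
  have : 0 ≤ Real.logb 2 e :=
    Real.logb_nonneg (by norm_num) (by exact_mod_cast Nat.one_le_iff_ne_zero.2 he)
  linarith

theorem pathWeight_nonneg (e : ℕ) : 0 ≤ pathWeight e := by
  rcases eq_or_ne e 0 with rfl | he
  · rw [pathWeight_zero]
  · exact zero_le_one.trans (one_le_pathWeight he)

/-- Splitting a nontrivial path into two nontrivial parts reduces twice its weight by at least
`2`, and splitting it at one of its ends reduces it by at least `1`. -/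
theorem pathWeight_split {x e : ℕ} (hx : x ≤ e) :
    pathWeight x + pathWeight (e - x) + 2 * (if e ≠ 0 then 1 else 0) ≤
      2 * pathWeight e + (if e ≠ 0 ∧ (x = 0 ∨ x = e) then 1 else 0) := by
  rcases eq_or_ne e 0 with rfl | he
  · obtain rfl : x = 0 := by omega
    simp [pathWeight_zero]
  have h1 := one_le_pathWeight he
  rcases eq_or_ne x 0 with rfl | hx0
  · rw [Nat.sub_zero, pathWeight_zero, if_pos he, if_pos ⟨he, Or.inl rfl⟩]
    linarith
  rcases eq_or_ne x e with rfl | hxe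
  · rw [Nat.sub_self, pathWeight_zero, if_pos he, if_pos ⟨he, Or.inr rfl⟩]
    linarith
  have hy0 : e - x ≠ 0 := by omega
  rw [if_pos he, if_neg (by tauto), pathWeight_of_ne_zero he, pathWeight_of_ne_zero hx0,
    pathWeight_of_ne_zero hy0, Nat.cast_sub hx]
  have hxR : (0 : ℝ) < x := by exact_mod_cast Nat.pos_of_ne_zero hx0
  have hyR : (0 : ℝ) < (e : ℝ) - x := by
    rw [sub_pos]; exact_mod_cast lt_of_le_of_ne hx hxe
  have heR : (0 : ℝ) < e := by linarith
  have h4 : Real.logb 2 4 = 2 := by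
    rw [show (4 : ℝ) = 2 ^ (2 : ℕ) by norm_num, Real.logb_pow, Real.logb_self_eq_one (by norm_num)]
    norm_num
  have hprod : Real.logb 2 (4 * (x * ((e : ℝ) - x))) ≤ Real.logb 2 ((e : ℝ) * e) :=
    Real.logb_le_logb_of_le (by norm_num) (by positivity)
      (by nlinarith [sq_nonneg ((e : ℝ) - 2 * x)])
  rw [Real.logb_mul (by norm_num) (by positivity), Real.logb_mul hxR.ne' hyR.ne',
    Real.logb_mul heR.ne' heR.ne', h4] at hprod
  linarith

/-- For `b ≥ 4` the crude bound `e < 2 ^ b` suffices; for `b = 2, 3` the number of edges being at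
most `2 ^ b - 2` matters. -/
theorem four_mul_pathWeight_le {e b : ℕ} (h : e + 1 < 2 ^ b) : 4 * pathWeight e ≤ 5 * b := by
  rcases eq_or_ne e 0 with rfl | he
  · rw [pathWeight_zero, mul_zero]; positivity
  have hpow : 16 * e ^ 4 ≤ 2 ^ (5 * b) := by
    rcases Nat.lt_or_ge b 4 with hb | hb
    · interval_cases b
      · omega
      · omega
      · have : e ≤ 2 := by omega
        calc 16 * e ^ 4 ≤ 16 * 2 ^ 4 := Nat.mul_le_mul_left _ (Nat.pow_le_pow_left this 4)
          _ ≤ 2 ^ (5 * 2) := by norm_num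
      · have : e ≤ 6 := by omega
        calc 16 * e ^ 4 ≤ 16 * 6 ^ 4 := Nat.mul_le_mul_left _ (Nat.pow_le_pow_left this 4)
          _ ≤ 2 ^ (5 * 3) := by norm_num
    · calc 16 * e ^ 4 ≤ 2 ^ b * (2 ^ b) ^ 4 := Nat.mul_le_mul
            (Nat.pow_le_pow_right (n := 2) (by norm_num) hb) (Nat.pow_le_pow_left (by omega) 4)
        _ = 2 ^ (5 * b) := by rw [← pow_mul, ← pow_add]; congr 1; ring
  have heR : (0 : ℝ) < e := by exact_mod_cast Nat.pos_of_ne_zero he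
  have hlog : Real.logb 2 (16 * (e : ℝ) ^ 4) ≤ Real.logb 2 ((2 : ℝ) ^ (5 * b)) :=
    Real.logb_le_logb_of_le (by norm_num) (by positivity) (by exact_mod_cast hpow)
  have h16 : Real.logb 2 16 = 4 := by
    rw [show (16 : ℝ) = 2 ^ (4 : ℕ) by norm_num, Real.logb_pow,
      Real.logb_self_eq_one (by norm_num)]
    norm_num
  rw [Real.logb_mul (by norm_num) (by positivity), h16, Real.logb_pow, Real.logb_pow,
    Real.logb_self_eq_one (by norm_num)] at hlog
  rw [pathWeight_of_ne_zero he]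
  push_cast at hlog
  linarith

/-- The total weight of the paths with labels in `F` and lengths `e`. -/
noncomputable def totalWeight {V : Type*} (F : Finset V) (e : V → ℕ) : ℝ :=
  ∑ s ∈ F, pathWeight (e s)

theorem card_le_totalWeight {V : Type*} (F : Finset V) (e : V → ℕ) :
    ((F.filter fun s => e s ≠ 0).card : ℝ) ≤ totalWeight F e := by
  rw [← Finset.sum_boole]
  refine Finset.sum_le_sum fun s _ => ?_
  split_ifs with h
  · exact one_le_pathWeight h
  · exact pathWeight_nonneg _

/-! ### Balanced cuts -/

section Cut

variable {V : Type*} [DecidableEq V] {G : SimpleGraph V} {X L Y : Finset V × Finset V}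

/-- Deleting the separator of `L` separates the part between `X` and `L` from the part between
`L` and `Y`. -/
theorem ElimBound.of_cut {k γ : ℕ} (hL : IsSeparation G L)
    (h₁ : ElimBound G k (L.1 \ X.2)) (h₂ : ElimBound G k (Y.1 \ L.2))
    (hγ : (separator L ∩ (Y.1 \ X.2)).card ≤ γ) : ElimBound G (k + γ) (Y.1 \ X.2) := by
  have hdisj : Disjoint (L.1 \ X.2) (Y.1 \ L.2) := Finset.disjoint_left.2 fun v hv hv' =>
    (Finset.mem_sdiff.1 hv').2 (hL.1 (Finset.mem_sdiff.1 hv).1)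
  have hadj : ∀ u ∈ L.1 \ X.2, ∀ v ∈ Y.1 \ L.2, ¬ G.Adj u v := fun u hu v hv huv =>
    (Finset.mem_sdiff.1 hv).2 (hL.2 u (Finset.mem_sdiff.1 hu).1 v huv)
  have h := (ElimBound.union h₁ h₂ hdisj hadj).union_card (separator L ∩ (Y.1 \ X.2))
  refine (h.mono (Nat.add_le_add_left hγ k)).subset fun v hv => ?_
  obtain ⟨hvY, hvX⟩ := Finset.mem_sdiff.1 hv
  simp only [Finset.mem_union, Finset.mem_inter, Finset.mem_sdiff, separator]
  tauto

/-- Cutting at two separations `L ≤ L'`: the cheaper separator is deleted first, so that on the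
far side of it only its own cost is charged. -/
theorem ElimBound.of_two_cuts {L' : Finset V × Finset V} {K k₁ k₂ k₃ γ γ' : ℕ}
    (hL : IsSeparation G L) (hL' : IsSeparation G L') (hXL : X ≤ L) (hL'Y : L' ≤ Y)
    (h₁ : ElimBound G k₁ (L.1 \ X.2)) (h₂ : ElimBound G k₂ (L'.1 \ L.2))
    (h₃ : ElimBound G k₃ (Y.1 \ L'.2))
    (hγ : (separator L ∩ (Y.1 \ X.2)).card ≤ γ) (hγ' : (separator L' ∩ (Y.1 \ X.2)).card ≤ γ')
    (hk₁ : k₁ + 2 * γ ≤ K) (hk₂ : k₂ + γ + γ' ≤ K) (hk₃ : k₃ + 2 * γ' ≤ K) :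
    ElimBound G K (Y.1 \ X.2) := by
  rcases le_total γ' γ with hle | hle
  · have hcost : (separator L ∩ (L'.1 \ X.2)).card ≤ γ := (Finset.card_le_card
      (Finset.inter_subset_inter_left (Finset.sdiff_subset_sdiff hL'Y.1 subset_rfl))).trans hγ
    have h := ElimBound.of_cut hL (h₁.mono (k' := K - γ - γ') (by omega))
      (h₂.mono (k' := K - γ - γ') (by omega)) hcost
    exact (ElimBound.of_cut hL' (h.mono (k' := K - γ') (by omega)) (h₃.mono (by omega))
      hγ').mono (by omega)
  · have hcost : (separator L' ∩ (Y.1 \ L.2)).card ≤ γ' := (Finset.card_le_card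
      (Finset.inter_subset_inter_left (Finset.sdiff_subset_sdiff subset_rfl hXL.2))).trans hγ'
    have h := ElimBound.of_cut hL' (h₂.mono (k' := K - γ - γ') (by omega))
      (h₃.mono (k' := K - γ - γ') (by omega)) hcost
    exact (ElimBound.of_cut hL (h₁.mono (k' := K - γ) (by omega)) (h.mono (by omega))
      hγ).mono (by omega)

/-- Let `q` be the number of nontrivial paths of a linkage. Cutting at a separation whose order
exceeds the number of paths by at most `q` costs some `γ ≤ 2 * q`, and the average total weight of
the two resulting linkages is at least `γ / 2` below the total weight. -/
theorem IsLinkage.exists_split_totalWeight {F : Finset V} {e : V → ℕ} {P : V → ℕ → V}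
    (h : IsLinkage G (separator X) (separator Y) F e P) (hL : IsSeparation G L)
    (hXL : X ≤ L) (hLY : L ≤ Y)
    (hcard : (separator L).card ≤ F.card + (F.filter fun s => e s ≠ 0).card) :
    ∃ (γ : ℕ) (e₁ e₂ : V → ℕ) (P₁ P₂ : V → ℕ → V),
      IsLinkage G (separator X) (separator L) F e₁ P₁ ∧
      IsLinkage G (separator L) (separator Y) F e₂ P₂ ∧
      (separator L ∩ (Y.1 \ X.2)).card ≤ γ ∧ γ ≤ 2 * (F.filter fun s => e s ≠ 0).card ∧
      totalWeight F e₁ + totalWeight F e₂ + γ ≤ 2 * totalWeight F e := by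
  obtain ⟨x, hx, h₁, h₂, hcost⟩ := h.exists_split hL hXL hLY
  set q := (F.filter fun s => e s ≠ 0).card with hq
  set m := (F.filter fun s => e s ≠ 0 ∧ (x s = 0 ∨ x s = e s)).card with hm
  have hmq : m ≤ q := Finset.card_le_card fun s hs =>
    Finset.mem_filter.2 ⟨(Finset.mem_filter.1 hs).1, (Finset.mem_filter.1 hs).2.1⟩
  have hfree : F.card + m ≤ (F.filter fun s => x s = 0 ∨ x s = e s).card + q := by
    have hF := Finset.card_filter_add_card_filter_not (s := F) (fun s => e s ≠ 0)
    have hsub : (F.filter fun s => ¬ e s ≠ 0).card + m ≤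
        (F.filter fun s => x s = 0 ∨ x s = e s).card := by
      rw [hm, ← Finset.card_union_of_disjoint]
      · refine Finset.card_le_card (Finset.union_subset (fun s hs => ?_) fun s hs => ?_)
        · obtain ⟨hs, he⟩ := Finset.mem_filter.1 hs
          have := hx s hs
          exact Finset.mem_filter.2 ⟨hs, Or.inl (by omega)⟩
        · exact Finset.mem_filter.2
            ⟨(Finset.mem_filter.1 hs).1, (Finset.mem_filter.1 hs).2.2⟩
      · exact Finset.disjoint_left.2 fun s hs hs' =>
          (Finset.mem_filter.1 hs).2 (Finset.mem_filter.1 hs').2.1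
    omega
  refine ⟨2 * q - m, x, fun s => e s - x s, P, fun s t => P s (x s + t), h₁, h₂, by omega,
    by omega, ?_⟩
  have hsum := Finset.sum_le_sum fun s (hs : s ∈ F) => pathWeight_split (hx s hs)
  rw [Finset.sum_add_distrib, Finset.sum_add_distrib, Finset.sum_add_distrib, ← Finset.mul_sum,
    ← Finset.mul_sum, Finset.sum_boole, Finset.sum_boole, ← hq, ← hm] at hsum
  rw [Nat.cast_sub (by omega)]
  push_cast
  unfold totalWeight
  linarith

end Cut

/-! ### The elimination strategy -/

section Strategy

variable {V : Type*} [Fintype V] [DecidableEq V] {G : SimpleGraph V} {a b N : ℕ}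
  {c : ℕ → Finset V × Finset V}

/-- Between two consecutive members of a sweep there is nothing left to eliminate. -/
theorem IsSweep.sdiff_succ_eq_empty (hc : IsSweep G a N c) (l : ℕ) :
    (c (l + 1)).1 \ (c l).2 = ∅ := by
  have hmono := hc.monotone (Nat.le_add_right l 1)
  have h₁ := Finset.card_le_card hmono.1
  have h₂ := Finset.card_le_card hmono.2
  have hstep := hc.step l
  unfold pairRank at hstep
  rw [Finset.sdiff_eq_empty_iff_subset]
  rcases Nat.lt_or_ge (c l).1.card (c (l + 1)).1.card with hlt | hge
  · rw [Finset.eq_of_subset_of_card_le hmono.2 (by omega)]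
    exact (hc.sep (l + 1)).1
  · rw [← Finset.eq_of_subset_of_card_le hmono.1 hge]
    exact (hc.sep l).1

/-- Trivial paths start in both separators, and they still do so after the window shrinks. -/
theorem IsLinkage.card_le_card_inter (hc : IsSweep G a N c) {i j i₁ j₁ : ℕ} (hi : i ≤ i₁)
    (hij : i₁ ≤ j₁) (hj : j₁ ≤ j) {F : Finset V} {e : V → ℕ} {P : V → ℕ → V}
    (h : IsLinkage G (separator (c i)) (separator (c j)) F e P) :
    (F.filter fun s => ¬ e s ≠ 0).card ≤ (separator (c i₁) ∩ separator (c j₁)).card := by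
  refine Finset.card_le_card_of_injOn (fun s => P s 0) ?_ ?_
  · intro s hs
    obtain ⟨hs, he⟩ := Finset.mem_filter.1 hs
    have h₁ := (Finset.mem_sdiff.1 (h.start_mem s hs)).1
    have h₂ := h.finish_mem s hs
    rw [not_not.1 he] at h₂
    have h₂ := (Finset.mem_sdiff.1 h₂).2
    exact Finset.mem_coe.2 (Finset.mem_inter.2
      ⟨Finset.mem_sdiff.2 ⟨(hc.monotone hi).2 h₁, fun h' => h₂ ((hc.monotone (hij.trans hj)).1 h')⟩,
        Finset.mem_sdiff.2 ⟨(hc.monotone (hi.trans hij)).2 h₁,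
          fun h' => h₂ ((hc.monotone hj).1 h')⟩⟩)
  · intro s hs s' hs' heq
    exact (h.inj s (Finset.mem_filter.1 hs).1 s' (Finset.mem_filter.1 hs').1 0 (Nat.zero_le _) 0
      (Nat.zero_le _) heq).1

/-- The number of levels that suffice for a window of a linked sweep of width `a` whose ends are
joined by disjoint paths with labels in `F` and lengths `e`. -/
noncomputable def levelBudget (a b : ℕ) (F : Finset V) (e : V → ℕ) : ℝ :=
  10 * b * (a - F.card) + 4 * totalWeight F e

/-- If all members of a linked sweep in a window have order greater than `|F| + q`, where `q` is
the number of nontrivial paths in a linkage of a larger window, then the window has a new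
linkage with more than `|F| + q` paths, of which the trivial ones are at least as many as before.
This lowers the budget by at least `4 * q + 2`. -/
theorem IsSweep.exists_linkage_of_lt_card (hc : IsSweep G a N c) (hlink : IsLinkedSweep G c)
    (hb : 1 ≤ b) (hpath : ¬ (SimpleGraph.pathGraph (2 ^ b)).IsContained G) {i j i₁ j₁ : ℕ}
    (hi : i ≤ i₁) (hij : i₁ ≤ j₁) (hj : j₁ ≤ j) {F : Finset V} {e : V → ℕ} {P : V → ℕ → V}
    (h : IsLinkage G (separator (c i)) (separator (c j)) F e P)
    (hlt : ∀ m, i₁ ≤ m → m ≤ j₁ →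
      F.card + (F.filter fun s => e s ≠ 0).card < (separator (c m)).card) :
    ∃ F' e' P', IsLinkage G (separator (c i₁)) (separator (c j₁)) F' e' P' ∧
      F.card < F'.card ∧
      levelBudget a b F' e' + 4 * (F.filter fun s => e s ≠ 0).card + 2 ≤ levelBudget a b F e := by
  obtain ⟨F', e', P', h', hF', htriv⟩ := exists_isLinkage_separator
    (k := F.card + (F.filter fun s => e s ≠ 0).card + 1) (hc.sep i₁) (hc.sep j₁) (hc.monotone hij)
    (fun Z hZ h₁ h₂ => by
      obtain ⟨m, hm₁, hm₂, hm⟩ := hlink i₁ j₁ Z hij hZ h₁ h₂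
      exact (hlt m hm₁ hm₂).trans_le hm)
  refine ⟨F', e', P', h', by omega, ?_⟩
  have hz := h.card_le_card_inter hc hi hij hj
  have hF := Finset.card_filter_add_card_filter_not (s := F) (fun s => e s ≠ 0)
  have hΦ := card_le_totalWeight F e
  have hΦ' : 4 * totalWeight F' e' ≤ 5 * b * (F'.filter fun s => e' s ≠ 0).card := by
    rw [totalWeight, Finset.mul_sum, ← Finset.sum_boole, Finset.mul_sum]
    refine Finset.sum_le_sum fun s hs => ?_
    split_ifs with h0
    · rw [mul_one]; exact four_mul_pathWeight_le (h'.lt_of_not_isContained hpath hs)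
    · rw [not_not.1 h0, pathWeight_zero]; simp
  set q := (F.filter fun s => e s ≠ 0).card
  set q' := (F'.filter fun s => e' s ≠ 0).card
  set z := (F.filter fun s => ¬ e s ≠ 0).card
  have h₁ : (q' : ℝ) + z ≤ F'.card := by exact_mod_cast (by omega : q' + z ≤ F'.card)
  have h₂ : (z : ℝ) + 2 * q + 1 ≤ F'.card := by
    exact_mod_cast (by omega : z + 2 * q + 1 ≤ F'.card)
  have h₃ : (F.card : ℝ) = q + z := by exact_mod_cast hF.symm
  have hbR : (1 : ℝ) ≤ b := by exact_mod_cast hb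
  unfold levelBudget
  rw [h₃]
  nlinarith [mul_nonneg (zero_le_one.trans hbR) (sub_nonneg.2 h₁),
    mul_nonneg (zero_le_one.trans hbR) (sub_nonneg.2 h₂)]

/-- The part of the graph strictly between two members of a linked sweep is eliminated within the
budget. Separations of order at most `|F| + q` are cheap. The window is cut at two separations
`l < l'` such that the part to the left of `l` and the part to the right of `l'` have light
linkages, while no separation in between is cheap. In the middle part the linkage is replaced by a
larger one. -/
theorem IsSweep.exists_elimBound (hc : IsSweep G a N c) (hlink : IsLinkedSweep G c)
    (hb : 1 ≤ b) (hpath : ¬ (SimpleGraph.pathGraph (2 ^ b)).IsContained G) (n : ℕ) :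
    ∀ {i j : ℕ} {F : Finset V} {e : V → ℕ} {P : V → ℕ → V}, i ≤ j →
      IsLinkage G (separator (c i)) (separator (c j)) F e P → (j - i) + (a - F.card) < n →
      ∃ k : ℕ, ElimBound G k ((c j).1 \ (c i).2) ∧ (k : ℝ) ≤ levelBudget a b F e := by
  classical
  induction n with
  | zero => intro i j F e P _ _ hn; exact absurd hn (Nat.not_lt_zero _)
  | succ n ih =>
    intro i j F e P hij h hn
    have hFa : F.card ≤ a := h.card_le.trans (hc.card_le i)
    have hFaR : (F.card : ℝ) ≤ a := by exact_mod_cast hFa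
    have hΦ := card_le_totalWeight F e
    set q := (F.filter fun s => e s ≠ 0).card with hq
    have hU : 4 * (q : ℝ) ≤ levelBudget a b F e := by
      have : 0 ≤ 10 * (b : ℝ) * (a - F.card) :=
        mul_nonneg (by positivity) (sub_nonneg.2 hFaR)
      unfold levelBudget
      linarith
    have hU0 : (0 : ℝ) ≤ levelBudget a b F e := le_trans (by positivity) hU
    rcases hij.eq_or_lt with rfl | hij
    · refine ⟨0, ?_, by exact_mod_cast hU0⟩
      rw [Finset.sdiff_eq_empty_iff_subset.2 (hc.sep i).1]
      exact .empty 0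
    -- `LL l`: cutting at `l` pays for itself on the left; `RL l`: it does so on the right.
    let LL : ℕ → Prop := fun l => ∃ γ k : ℕ,
      (separator (c l) ∩ ((c j).1 \ (c i).2)).card ≤ γ ∧ γ ≤ 2 * q ∧
      ElimBound G k ((c l).1 \ (c i).2) ∧ (k : ℝ) + 2 * γ ≤ levelBudget a b F e
    let RL : ℕ → Prop := fun l => ∃ γ k : ℕ,
      (separator (c l) ∩ ((c j).1 \ (c i).2)).card ≤ γ ∧ γ ≤ 2 * q ∧
      ElimBound G k ((c j).1 \ (c l).2) ∧ (k : ℝ) + 2 * γ ≤ levelBudget a b F e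
    have hLLi : LL i := by
      refine ⟨0, 0, ?_, Nat.zero_le _, ?_, by simpa using hU0⟩
      · rw [Nat.le_zero, Finset.card_eq_zero]
        refine Finset.eq_empty_of_forall_notMem fun v hv => ?_
        obtain ⟨h₁, h₂⟩ := Finset.mem_inter.1 hv
        exact (Finset.mem_sdiff.1 h₂).2 (Finset.mem_sdiff.1 h₁).1
      · rw [Finset.sdiff_eq_empty_iff_subset.2 (hc.sep i).1]
        exact .empty 0
    have hRLj : RL j := by
      refine ⟨0, 0, ?_, Nat.zero_le _, ?_, by simpa using hU0⟩
      · rw [Nat.le_zero, Finset.card_eq_zero]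
        refine Finset.eq_empty_of_forall_notMem fun v hv => ?_
        obtain ⟨h₁, h₂⟩ := Finset.mem_inter.1 hv
        exact (Finset.mem_sdiff.1 h₁).2 (Finset.mem_sdiff.1 h₂).1
      · rw [Finset.sdiff_eq_empty_iff_subset.2 (hc.sep j).1]
        exact .empty 0
    have hcheap : ∀ l, i < l → l < j → (separator (c l)).card ≤ F.card + q → LL l ∨ RL l := by
      intro l hil hlj hl
      obtain ⟨γ, e₁, e₂, P₁, P₂, h₁, h₂, hγ, hγq, hw⟩ := h.exists_split_totalWeight (hc.sep l)
        (hc.monotone hil.le) (hc.monotone hlj.le) hl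
      rcases le_total (totalWeight F e₁) (totalWeight F e₂) with hle | hle
      · obtain ⟨k, hk, hkU⟩ := ih hil.le h₁ (by omega)
        refine Or.inl ⟨γ, k, hγ, hγq, hk, ?_⟩
        unfold levelBudget at hkU ⊢
        linarith
      · obtain ⟨k, hk, hkU⟩ := ih hlj.le h₂ (by omega)
        refine Or.inr ⟨γ, k, hγ, hγq, hk, ?_⟩
        unfold levelBudget at hkU ⊢
        linarith
    obtain ⟨l, hlj, hLLl, hlmax⟩ : ∃ l, l < j ∧ LL l ∧ ∀ m, l < m → m < j → ¬ LL m := by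
      have hspec := Nat.findGreatest_spec (P := LL) (n := j - 1) (m := i) (by omega) hLLi
      have hle := Nat.findGreatest_le (P := LL) (j - 1)
      exact ⟨_, by omega, hspec, fun m hm hmj =>
        Nat.findGreatest_is_greatest hm (by omega)⟩
    have hil : i ≤ l := by
      by_contra hcon
      exact hlmax i (not_le.1 hcon) hij hLLi
    have hex : ∃ l', l < l' ∧ RL l' := ⟨j, hlj, hRLj⟩
    obtain ⟨l', hll', hl'j, hRLl', hlmin⟩ :
        ∃ l', l < l' ∧ l' ≤ j ∧ RL l' ∧ ∀ m, l < m → m < l' → ¬ RL m :=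
      ⟨Nat.find hex, (Nat.find_spec hex).1, Nat.find_min' hex ⟨hlj, hRLj⟩, (Nat.find_spec hex).2,
        fun m hlm hm hRL => Nat.find_min hex hm ⟨hlm, hRL⟩⟩
    have hmid : ∃ k : ℕ, ElimBound G k ((c l').1 \ (c l).2) ∧
        (k : ℝ) + 4 * q ≤ levelBudget a b F e := by
      rcases (Nat.succ_le_of_lt hll').eq_or_lt with hsucc | hsucc
      · refine ⟨0, ?_, by simpa using hU⟩
        rw [← hsucc, hc.sdiff_succ_eq_empty l]
        exact .empty 0
      · obtain ⟨p, rfl⟩ : ∃ p, l' = p + 1 := ⟨l' - 1, by omega⟩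
        -- Passing to the window from `l + 1` to `p` costs one more vertex on either side.
        obtain ⟨F', e', P', h', hFF', hbudget⟩ := hc.exists_linkage_of_lt_card hlink hb hpath
          (i₁ := l + 1) (j₁ := p) (by omega) (by omega) (by omega) h fun m hm₁ hm₂ => by
            by_contra hcon
            rcases hcheap m (by omega) (by omega) (not_lt.1 hcon) with hm | hm
            · exact hlmax m (by omega) (by omega) hm
            · exact hlmin m (by omega) (by omega) hm
        have hF'a : F'.card ≤ a := h'.card_le.trans (hc.card_le _)
        obtain ⟨k, hk, hkU⟩ := ih (by omega) h' (by omega)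
        refine ⟨k + 2, ?_, by push_cast; linarith⟩
        have hX := hk.union_card (((c (l + 1)).2 \ (c l).2) ∪ ((c (p + 1)).1 \ (c p).1))
        refine (hX.mono ?_).subset fun v hv => ?_
        · have h₁ := Finset.card_sdiff_add_card_eq_card (hc.monotone (Nat.le_add_right l 1)).2
          have h₂ := Finset.card_sdiff_add_card_eq_card (hc.monotone (Nat.le_add_right p 1)).1
          have h₃ := Finset.card_le_card (hc.monotone (Nat.le_add_right l 1)).1
          have h₄ := Finset.card_le_card (hc.monotone (Nat.le_add_right p 1)).2
          have h₅ := hc.step l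
          have h₆ := hc.step p
          unfold pairRank at h₅ h₆
          have h₇ := Finset.card_union_le ((c (l + 1)).2 \ (c l).2) ((c (p + 1)).1 \ (c p).1)
          omega
        · simp only [Finset.mem_union, Finset.mem_sdiff] at hv ⊢
          tauto
    obtain ⟨γ, k₁, hγ, hγq, hk₁, hk₁U⟩ := hLLl
    obtain ⟨γ', k₃, hγ', hγ'q, hk₃, hk₃U⟩ := hRLl'
    obtain ⟨k₂, hk₂, hk₂U⟩ := hmid
    have hγR : (γ : ℝ) ≤ 2 * q := by exact_mod_cast hγq
    have hγ'R : (γ' : ℝ) ≤ 2 * q := by exact_mod_cast hγ'q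
    refine ⟨⌊levelBudget a b F e⌋₊, ?_, Nat.floor_le hU0⟩
    exact ElimBound.of_two_cuts (hc.sep l) (hc.sep l') (hc.monotone hil) (hc.monotone hl'j)
      hk₁ hk₂ hk₃ hγ hγ' (Nat.le_floor (by push_cast; exact hk₁U))
      (Nat.le_floor (by push_cast; linarith)) (Nat.le_floor (by push_cast; exact hk₃U))

end Strategy

/-! ### The treedepth bound -/

theorem exists_pathDecomposition_of_pathwidth_lt {V : Type*} [Finite V] {G : SimpleGraph V}
    {a : ℕ} (h : pathwidth G < (a : ℤ)) :
    ∃ (n : ℕ) (D : PathDecomposition G n), ∀ t, (D.bag t).card ≤ a := by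
  cases nonempty_fintype V
  have hne : {w : ℤ | ∃ (n : ℕ) (D : PathDecomposition G n), D.width = w}.Nonempty :=
    ⟨_, 0,
      { bag := fun _ => Finset.univ
        exists_bag_of_adj := fun u v _ => ⟨0, Finset.mem_univ u, Finset.mem_univ v⟩
        nonempty_nodes := fun v => ⟨0, Finset.mem_univ v⟩
        ordConnected_nodes := fun v => ⟨fun _ _ _ _ _ _ => Finset.mem_univ v⟩ }, rfl⟩
  obtain ⟨w, ⟨n, D, rfl⟩, hw⟩ := exists_lt_of_csInf_lt hne h
  refine ⟨n, D, fun t => ?_⟩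
  have hle : (D.bag t).card ≤ Finset.univ.sup fun t => (D.bag t).card :=
    Finset.le_sup (f := fun t => (D.bag t).card) (Finset.mem_univ t)
  unfold PathDecomposition.width at hw
  omega

theorem theorem3 {V : Type*} [Finite V] (G : SimpleGraph V) (a b : ℕ)
    (hpw : pathwidth G < (a : ℤ))
    (hpath : ¬ (SimpleGraph.pathGraph (2 ^ b)).IsContained G) :
    treedepth G ≤ 10 * a * b := by
  classical
  cases nonempty_fintype V
  suffices h : ElimBound G (10 * a * b) Finset.univ by
    obtain ⟨r, d, hr⟩ := h.exists_isElimData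
    exact hr.treedepth_le
  rcases Nat.eq_zero_or_pos b with rfl | hb
  · -- A single vertex is a path on `2 ^ 0` vertices, so there is no vertex.
    have hV : (Finset.univ : Finset V) = ∅ := by
      refine Finset.eq_empty_of_forall_notMem fun v _ => hpath ⟨⟨⟨fun _ => v, ?_⟩, ?_⟩⟩
      · intro i j hij
        have hi : (i : ℕ) < 1 := i.2
        have hj : (j : ℕ) < 1 := j.2
        rcases SimpleGraph.pathGraph_adj.1 hij with hij | hij <;> omega
      · intro i j _
        have hi : (i : ℕ) < 1 := i.2
        have hj : (j : ℕ) < 1 := j.2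
        exact Fin.ext (by omega)
    rw [hV]
    exact .empty _
  obtain ⟨n, D, hD⟩ := exists_pathDecomposition_of_pathwidth_lt hpw
  obtain ⟨N₀, c₀, hc₀⟩ := D.exists_isSweep hD
  obtain ⟨N, c, hc, hlink⟩ := hc₀.exists_isLinkedSweep
  have hempty : IsLinkage G (separator (c 0)) (separator (c N)) ∅ (fun _ => 0) (fun s _ => s) := by
    constructor <;> simp
  obtain ⟨k, hk, hkU⟩ := hc.exists_elimBound hlink hb hpath _ (Nat.zero_le N) hempty
    (Nat.lt_succ_self _)
  have huniv : (c N).1 \ (c 0).2 = Finset.univ := by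
    rw [hc.top, hc.zero]
    exact Finset.sdiff_empty
  rw [huniv] at hk
  refine hk.mono ?_
  have hcast : (k : ℝ) ≤ ((10 * a * b : ℕ) : ℝ) := by
    simp only [levelBudget, totalWeight, Finset.card_empty, Finset.sum_empty] at hkU
    push_cast at hkU ⊢
    linarith
  exact_mod_cast hcast
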